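/- Let $A$ be a real $l\times m$ matrix and $B$ a real $m\times n$ matrix with $AB\neq 0$. For a nonzero real vector $v$ and a nonzero real matrix $M$ write $|v\rangle=\|v\|_2^{-1}\sum_k v_k|k\rangle$ and $|M\rangle=\|M\|_F^{-1}\sum_{i,j}M_{ij}|i,j\rangle$, where indices are stored in binary and $\|\cdot\|_F$ is the Frobenius norm. Suppose that unitaries preparing the rows of $A$ and the columns of $B$ are available as black boxes, i.e. unitaries that map, for every nonzero row $A_{i\bullet}$ and every nonzero column $B_{\bullet j}$, $$|i\rangle|0\rangle\mapsto|i\rangle|A_{i\bullet}\rangle,\qquad |j\rangle|0\rangle\mapsto|j\rangle|B_{\bullet j}\rangle,\qquad |0\rangle\mapsto\frac1{\|A\|_F}\sum_i\|A_{i\bullet}\|_2|i\rangle,\qquad |0\rangle\mapsto\frac1{\|B\|_F}\sum_j\|B_{\bullet j}\|_2|j\rangle .$$ Then the quantum state $|AB\rangle$ can be obtained to accuracy $\epsilon$ in time $\widetilde O\big(\|A\|_F^3\|B\|_F^3/(\|AB\|_F^3\,\epsilon)\big)$. Precisely: there are constants $K,c\in\mathbb N$ such that for all $l,m,n\in\mathbb{N}$,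 all $\epsilon>0$ and all $R\ge 1$ there is a quantum circuit, built from gates on at most two qubits and (possibly controlled) queries to the four unitaries and their inverses, with at most $$K\,\frac{R^3}{\epsilon}\,\log^c\!\Big(2+\frac{lmnR}{\epsilon}\Big)$$ gates and queries in total, such that for all $A,B$ as above with $\|A\|_F\|B\|_F/\|AB\|_F\le R$, and for all unitaries as above, the circuit run on $|0\cdots0\rangle$ ends in a state within Euclidean distance $\epsilon$ of $|AB\rangle\otimes|\chi\rangle$ for some normalized state $|\chi\rangle$ of the work qubits. (In particular one may take $R=\|A\|_F\|B\|_F/\|AB\|_F$.) -/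

import Mathlib

open scoped Matrix Matrix.Norms.Frobenius

noncomputable section

namespace QMatMul

/-! ## Qubit registers -/

/-- A (not necessarily normalised) state vector of `N` qubits, given by its amplitudes in the
computational basis, which is indexed by bit strings. -/
abbrev State (N : ℕ) : Type := (Fin N → Bool) → ℂ

/-- The Euclidean (`ℓ²`) norm of a state vector. -/
def State.norm {N : ℕ} (ψ : State N) : ℝ := ‖WithLp.toLp 2 ψ‖

/-- The computational basis state `|x⟩`. -/
def ket {N : ℕ} (x : Fin N → Bool) : State N := Pi.single x 1

/-- The all-zero basis state `|0…0⟩`. -/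
def ketZero (N : ℕ) : State N := ket (fun _ => false)

/-- The tensor product of an `a`-qubit state and a `b`-qubit state (the first `a` qubits carry
`ψ`, the last `b` qubits carry `φ`). -/
def tensor {a b : ℕ} (ψ : State a) (φ : State b) : State (a + b) :=
  fun x => ψ (fun i => x (Fin.castAdd b i)) * φ (fun j => x (Fin.natAdd a j))

/-- The number `⌈log₂ d⌉` of qubits of a register that holds an index `k < d`. -/
abbrev qubits (d : ℕ) : ℕ := Nat.clog 2 d

/-- The basis state `|k⟩` of the register for indices `k < d`, in binary. -/
def idx {d : ℕ} (k : Fin d) : State (qubits d) := ket (fun t => Nat.testBit k.val t.val)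

/-- The Euclidean norm of a real vector. -/
def vecNorm {d : ℕ} (v : Fin d → ℝ) : ℝ := ‖WithLp.toLp 2 v‖

/-- The quantum state `|v⟩ = ‖v‖₂⁻¹ ∑ₖ vₖ |k⟩` of a (nonzero) real vector. -/
def vecState {d : ℕ} (v : Fin d → ℝ) : State (qubits d) :=
  ∑ k, ((v k / vecNorm v : ℝ) : ℂ) • idx k

/-- The quantum state `|M⟩ = ‖M‖_F⁻¹ ∑ᵢⱼ Mᵢⱼ |i, j⟩` of a (nonzero) real matrix; `‖M‖` is the
Frobenius norm. -/
def matState {l n : ℕ} (M : Matrix (Fin l) (Fin n) ℝ) : State (qubits l + qubits n) :=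
  ∑ i, ∑ j, ((M i j / ‖M‖ : ℝ) : ℂ) • tensor (idx i) (idx j)

/-- The vector of the Euclidean norms of the rows of `M`. -/
def rowNorms {l n : ℕ} (M : Matrix (Fin l) (Fin n) ℝ) : Fin l → ℝ := fun i => vecNorm (M i)

/-- The vector of the Euclidean norms of the columns of `M`. -/
def colNorms {l n : ℕ} (M : Matrix (Fin l) (Fin n) ℝ) : Fin n → ℝ := rowNorms Mᵀ

/-! ## The input: state preparation unitaries for the rows of `A` and the columns of `B` -/

/-- The names of the four state preparation unitaries. -/
inductive Oracle
  /-- `|i⟩|0⟩ ↦ |i⟩|Aᵢ⟩`, where `Aᵢ` is the `i`-th row of `A` -/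
  | rowA
  /-- `|0⟩ ↦` the state of the vector of row norms of `A` -/
  | normA
  /-- `|j⟩|0⟩ ↦ |j⟩|Bⱼ⟩`, where `Bⱼ` is the `j`-th column of `B` -/
  | colB
  /-- `|0⟩ ↦` the state of the vector of column norms of `B` -/
  | normB

/-- The number of qubits each oracle acts on, when `A` is `l × m` and `B` is `m × n`. -/
abbrev Oracle.width (l m n : ℕ) : Oracle → ℕ
  | .rowA => qubits l + qubits m
  | .normA => qubits l
  | .colB => qubits n + qubits m
  | .normB => qubits n

/-- A unitary for each of the four oracle names. -/
abbrev OracleFamily (l m n : ℕ) : Type :=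
  (o : Oracle) → Matrix.unitaryGroup (Fin (o.width l m n) → Bool) ℂ

/-- The unitaries `O` prepare the data of `A` and `B`. Nothing is required on the indices of zero
rows or columns (which have no normalised state), on the padding indices, or on inputs whose data
register is not `|0⟩`. -/
structure Prepares {l m n : ℕ} (O : OracleFamily l m n)
    (A : Matrix (Fin l) (Fin m) ℝ) (B : Matrix (Fin m) (Fin n) ℝ) : Prop where
  rowA : ∀ i, A i ≠ 0 →
    (O .rowA).val *ᵥ (tensor (idx i) (ketZero (qubits m)) : State (qubits l + qubits m))
      = tensor (idx i) (vecState (A i))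
  normA : (O .normA).val *ᵥ (ketZero (qubits l) : State (qubits l)) = vecState (rowNorms A)
  colB : ∀ j, Bᵀ j ≠ 0 →
    (O .colB).val *ᵥ (tensor (idx j) (ketZero (qubits m)) : State (qubits n + qubits m))
      = tensor (idx j) (vecState (Bᵀ j))
  normB : (O .normB).val *ᵥ (ketZero (qubits n) : State (qubits n)) = vecState (colNorms B)

/-! ## Quantum circuits with oracle queries -/

/-- The operator `U` on `k` qubits, applied to the qubits `e 0, …, e (k - 1)` of `N` qubits and
extended by the identity on the others. -/
def onQubits {k N : ℕ} (e : Fin k ↪ Fin N) (U : Matrix (Fin k → Bool) (Fin k → Bool) ℂ) :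
    Matrix (Fin N → Bool) (Fin N → Bool) ℂ :=
  Matrix.of fun x y =>
    if ∀ q, (∀ t, e t ≠ q) → x q = y q then U (x ∘ e) (y ∘ e) else 0

/-- The operator `U` controlled by an additional first qubit. -/
def controlled {k : ℕ} (U : Matrix (Fin k → Bool) (Fin k → Bool) ℂ) :
    Matrix (Fin (k + 1) → Bool) (Fin (k + 1) → Bool) ℂ :=
  Matrix.of fun x y =>
    if x 0 = y 0 then
      (if x 0 = true then U (Fin.tail x) (Fin.tail y)
        else (1 : Matrix (Fin k → Bool) (Fin k → Bool) ℂ) (Fin.tail x) (Fin.tail y))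
    else 0

/-- One elementary operation of a circuit on `N` qubits: an arbitrary gate on at most two qubits,
or a query to one of the oracles or to its inverse, plain or controlled by one qubit. -/
inductive Op (l m n N : ℕ)
  | gate (k : ℕ) (hk : k ≤ 2) (e : Fin k ↪ Fin N) (g : Matrix.unitaryGroup (Fin k → Bool) ℂ)
  | query (o : Oracle) (inverse : Bool) (e : Fin (o.width l m n) ↪ Fin N)
  | cquery (o : Oracle) (inverse : Bool) (e : Fin (o.width l m n + 1) ↪ Fin N)

/-- The matrix of an oracle, or of its inverse. -/
def oracleMatrix {l m n : ℕ} (O : OracleFamily l m n) (o : Oracle) (inverse : Bool) :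
    Matrix (Fin (o.width l m n) → Bool) (Fin (o.width l m n) → Bool) ℂ :=
  if inverse = true then ((O o)⁻¹).val else (O o).val

/-- The operator on `N` qubits that an elementary operation performs. -/
def Op.toMatrix {l m n N : ℕ} (O : OracleFamily l m n) :
    Op l m n N → Matrix (Fin N → Bool) (Fin N → Bool) ℂ
  | .gate _ _ e g => onQubits e g.val
  | .query o inverse e => onQubits e (oracleMatrix O o inverse)
  | .cquery o inverse e => onQubits e (controlled (oracleMatrix O o inverse))

/-- A circuit is a finite sequence of elementary operations; it does not refer to the unitaries
that answer its queries. -/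
abbrev Circuit (l m n N : ℕ) : Type := List (Op l m n N)

/-- The running time of a circuit: each gate and each query takes one step. -/
def Circuit.time {l m n N : ℕ} (Q : Circuit l m n N) : ℕ := List.length Q

/-- The final state of a circuit that is run on `|0…0⟩`, with the first operation of the list
applied first. -/
def Circuit.run {l m n N : ℕ} (Q : Circuit l m n N) (O : OracleFamily l m n) : State N :=
  List.foldl (fun ψ op => op.toMatrix O *ᵥ ψ) (ketZero N) Q

/-- The circuit, which has `w` work qubits after its `a` output qubits, obtains the state `φ` to
accuracy `ε` in its output register: its final state is within `ε` of `φ ⊗ χ` for a normalised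
state `χ` of the work qubits. -/
def Circuit.Obtains {l m n a w : ℕ} (Q : Circuit l m n (a + w)) (O : OracleFamily l m n)
    (φ : State a) (ε : ℝ) : Prop :=
  ∃ χ : State w, State.norm χ = 1 ∧ State.norm (Q.run O - tensor φ χ) ≤ ε

end QMatMul

end

/-!
Write `|i⟩|j⟩|k⟩` for a row index, a column index and a summation index. The state
`∑ᵢ ‖Aᵢ‖ |i⟩ ⊗ ∑ⱼ ‖Bⱼ‖ |j⟩` becomes `|A⟩` with a weight `‖Bⱼ‖` on each `j` after one query to the
rows of `A`, and undoing the preparation of the columns of `B` leaves the inner product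
`(A * B) i j` as the amplitude of `|i⟩|j⟩|0⟩`. So `|A * B⟩` appears with the amplitude
`s = ‖A * B‖ / (‖A‖ * ‖B‖) ≥ 1 / R`, which depends on the unknown matrices. It is amplified by
Grover's fixed-point search: if a unitary `V` fails to reach the target with probability `δ`, then
`V S V† T V` fails with probability `δ ^ 3`, where `S` and `T` are selective phase shifts by `π / 3`
and no knowledge of `δ` is needed. After `k` rounds, that is `3 ^ k` uses of `V`, the failure
probability is `(1 - s ^ 2) ^ 3 ^ k`, so that `3 ^ k ≈ R ^ 2 * log (1 / ε)` uses suffice.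
-/

noncomputable section

namespace QMatMul

/-! ## Operators on some of the qubits -/

section OnQubits

variable {k N : ℕ}

lemma extend_eq_iff {α β γ : Type*} {e : α → β} (he : Function.Injective e) {z : α → γ}
    {x y : β → γ} :
    Function.extend e z x = y ↔ y ∘ e = z ∧ ∀ q, (∀ t, e t ≠ q) → y q = x q := by
  constructor
  · rintro rfl
    refine ⟨Function.extend_comp he z x, fun q hq => Function.extend_apply' _ _ _ ?_⟩
    exact fun ⟨t, ht⟩ => hq t ht
  · rintro ⟨rfl, hx⟩
    funext q
    by_cases hq : ∃ t, e t = q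
    · obtain ⟨t, rfl⟩ := hq
      exact he.extend_apply _ _ t
    · rw [Function.extend_apply' _ _ _ hq, hx q (not_exists.mp hq)]

lemma extend_extend {α β γ : Type*} {e : α → β} (he : Function.Injective e) (z w : α → γ)
    (x : β → γ) : Function.extend e w (Function.extend e z x) = Function.extend e w x := by
  obtain ⟨-, hx⟩ := (extend_eq_iff he (z := z) (x := x)).mp rfl
  obtain ⟨hw, hy⟩ := (extend_eq_iff he (z := w) (x := x)).mp rfl
  exact (extend_eq_iff he).mpr ⟨hw, fun q hq => (hy q hq).trans (hx q hq).symm⟩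

lemma extend_comp_self {α β γ : Type*} {e : α → β} (he : Function.Injective e) (x : β → γ) :
    Function.extend e (x ∘ e) x = x :=
  (extend_eq_iff he).mpr ⟨rfl, fun _ _ => rfl⟩

lemma onQubits_mulVec (e : Fin k ↪ Fin N) (U : Matrix (Fin k → Bool) (Fin k → Bool) ℂ)
    (ψ : State N) (x : Fin N → Bool) :
    (onQubits e U *ᵥ ψ) x = ∑ z, U (x ∘ e) z * ψ (Function.extend e z x) := by
  symm
  refine Fintype.sum_of_injective (fun z => Function.extend e z x) ?_ _ _ ?_ ?_
  · exact Function.extend_injective e.injective x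
  · intro y hy
    change onQubits e U x y * ψ y = 0
    rw [onQubits, Matrix.of_apply, if_neg, zero_mul]
    exact fun h => hy ⟨y ∘ e, (extend_eq_iff e.injective).mpr ⟨rfl, fun q hq => (h q hq).symm⟩⟩
  · intro z
    obtain ⟨hz, hx⟩ := (extend_eq_iff e.injective (z := z) (x := x)).mp rfl
    change _ = onQubits e U x _ * ψ _
    rw [onQubits, Matrix.of_apply, if_pos fun q hq => (hx q hq).symm, hz]

lemma onQubits_mul (e : Fin k ↪ Fin N) (U V : Matrix (Fin k → Bool) (Fin k → Bool) ℂ) :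
    onQubits e (U * V) = onQubits e U * onQubits e V := by
  refine Matrix.ext_of_mulVec_single fun y => ?_
  rw [← Matrix.mulVec_mulVec]
  generalize (Pi.single y 1 : State N) = ψ
  funext x
  simp only [onQubits_mulVec, Function.extend_comp e.injective, extend_extend e.injective,
    Matrix.mul_apply, Finset.sum_mul, Finset.mul_sum, mul_assoc]
  exact Finset.sum_comm

lemma onQubits_one (e : Fin k ↪ Fin N) :
    onQubits e (1 : Matrix (Fin k → Bool) (Fin k → Bool) ℂ) = 1 := by
  refine Matrix.ext_of_mulVec_single fun y => ?_
  funext x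
  simp only [onQubits_mulVec, Matrix.one_mulVec, Matrix.one_apply, ite_mul, one_mul, zero_mul,
    Finset.sum_ite_eq, Finset.mem_univ, if_true, extend_comp_self e.injective]

lemma onQubits_conjTranspose (e : Fin k ↪ Fin N) (U : Matrix (Fin k → Bool) (Fin k → Bool) ℂ) :
    (onQubits e U)ᴴ = onQubits e Uᴴ := by
  ext x y
  simp only [onQubits, Matrix.conjTranspose_apply, Matrix.of_apply, apply_ite star, star_zero,
    eq_comm]

lemma onQubits_mem_unitaryGroup (e : Fin k ↪ Fin N) {U : Matrix (Fin k → Bool) (Fin k → Bool) ℂ}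
    (hU : U ∈ Matrix.unitaryGroup (Fin k → Bool) ℂ) :
    onQubits e U ∈ Matrix.unitaryGroup (Fin N → Bool) ℂ := by
  rw [Matrix.mem_unitaryGroup_iff, Matrix.star_eq_conjTranspose] at hU ⊢
  rw [onQubits_conjTranspose, ← onQubits_mul, hU, onQubits_one]

lemma controlled_eq_submatrix (U : Matrix (Fin k → Bool) (Fin k → Bool) ℂ) :
    controlled U = (Matrix.blockDiagonal fun b : Bool => if b = true then U else 1).submatrix
      ((Fin.consEquiv fun _ : Fin (k + 1) => Bool).symm.trans (Equiv.prodComm _ _))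
      ((Fin.consEquiv fun _ : Fin (k + 1) => Bool).symm.trans (Equiv.prodComm _ _)) := by
  ext x y
  simp only [controlled, Matrix.of_apply, Matrix.submatrix_apply, Matrix.blockDiagonal_apply,
    Equiv.trans_apply, Fin.consEquiv_symm_apply, Equiv.prodComm_apply, Prod.fst_swap,
    Prod.snd_swap]
  split_ifs <;> rfl

lemma controlled_conjTranspose (U : Matrix (Fin k → Bool) (Fin k → Bool) ℂ) :
    (controlled U)ᴴ = controlled Uᴴ := by
  rw [controlled_eq_submatrix, controlled_eq_submatrix, Matrix.conjTranspose_submatrix,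
    Matrix.blockDiagonal_conjTranspose]
  simp only [apply_ite Matrix.conjTranspose, Matrix.conjTranspose_one]

lemma controlled_mul (U V : Matrix (Fin k → Bool) (Fin k → Bool) ℂ) :
    controlled (U * V) = controlled U * controlled V := by
  simp only [controlled_eq_submatrix, Matrix.submatrix_mul_equiv, ← Matrix.blockDiagonal_mul,
    ite_mul_ite, mul_one]

lemma controlled_one : controlled (1 : Matrix (Fin k → Bool) (Fin k → Bool) ℂ) = 1 := by
  rw [controlled_eq_submatrix]
  simp only [ite_self]
  exact (congrArg (Matrix.submatrix · _ _) Matrix.blockDiagonal_one).trans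
    (Matrix.submatrix_one_equiv _)

lemma controlled_mem_unitaryGroup {U : Matrix (Fin k → Bool) (Fin k → Bool) ℂ}
    (hU : U ∈ Matrix.unitaryGroup (Fin k → Bool) ℂ) :
    controlled U ∈ Matrix.unitaryGroup (Fin (k + 1) → Bool) ℂ := by
  rw [Matrix.mem_unitaryGroup_iff, Matrix.star_eq_conjTranspose] at hU ⊢
  rw [controlled_conjTranspose, ← controlled_mul, hU, controlled_one]

lemma onQubits_controlled_mulVec (e : Fin (k + 1) ↪ Fin N)
    (U : Matrix (Fin k → Bool) (Fin k → Bool) ℂ) (ψ : State N) (x : Fin N → Bool) :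
    (onQubits e (controlled U) *ᵥ ψ) x =
      if x (e 0) = true then (onQubits ((Fin.succEmb k).trans e) U *ᵥ ψ) x else ψ x := by
  have hext (z : Fin k → Bool) :
      Function.extend e (Fin.cons (x (e 0)) z : Fin (k + 1) → Bool) x =
        Function.extend ((Fin.succEmb k).trans e) z x := by
    obtain ⟨hz, hx⟩ :=
      (extend_eq_iff ((Fin.succEmb k).trans e).injective (z := z) (x := x)).mp rfl
    refine (extend_eq_iff e.injective).mpr ⟨?_, fun q hq => hx q fun t => hq t.succ⟩
    rw [← Fin.cons_self_tail (_ ∘ e)]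
    exact congrArg₂ Fin.cons (hx _ fun t ht => Fin.succ_ne_zero t (e.injective ht)) hz
  have hentry (b : Bool) (z : Fin k → Bool) :
      controlled U (x ∘ e) (Fin.cons b z : Fin (k + 1) → Bool) = if x (e 0) = b then
        (if x (e 0) = true then U else 1) (x ∘ (Fin.succEmb k).trans e) z else 0 := by
    simp only [controlled, Matrix.of_apply, Fin.cons_zero, Fin.tail_cons, Function.comp_apply]
    split_ifs <;> rfl
  have hsum : (onQubits e (controlled U) *ᵥ ψ) x =
      (onQubits ((Fin.succEmb k).trans e) (if x (e 0) = true then U else 1) *ᵥ ψ) x := by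
    rw [onQubits_mulVec, onQubits_mulVec, ← (Fin.consEquiv fun _ => Bool).sum_comp,
      Fintype.sum_prod_type, Finset.sum_eq_single (x (e 0))]
    · refine Finset.sum_congr rfl fun z _ => ?_
      exact congrArg₂ (· * ψ ·) ((hentry _ z).trans (if_pos rfl)) (hext z)
    · intro b _ hb
      refine Finset.sum_eq_zero fun z _ => ?_
      exact (congrArg (· * _) ((hentry b z).trans (if_neg hb.symm))).trans (zero_mul _)
    · exact fun h => absurd (Finset.mem_univ _) h
  rw [hsum]
  split_ifs
  · rfl
  · rw [onQubits_one, Matrix.one_mulVec]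

end OnQubits

/-! ## The operator of a circuit -/

section Circuits

variable {l m n D N : ℕ}

/-- The operator that a circuit performs. -/
def Circuit.toMatrix (O : OracleFamily l m n) :
    Circuit l m n N → Matrix (Fin N → Bool) (Fin N → Bool) ℂ
  | [] => 1
  | op :: Q => Circuit.toMatrix O Q * op.toMatrix O

lemma Circuit.toMatrix_append (O : OracleFamily l m n) (Q Q' : Circuit l m n N) :
    Circuit.toMatrix O (Q ++ Q') = Circuit.toMatrix O Q' * Circuit.toMatrix O Q := by
  induction Q with
  | nil => exact (mul_one _).symm
  | cons op Q ih => rw [List.cons_append, toMatrix, ih, toMatrix, mul_assoc]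

lemma Circuit.toMatrix_singleton (O : OracleFamily l m n) (op : Op l m n N) :
    Circuit.toMatrix O [op] = op.toMatrix O :=
  one_mul _

lemma Circuit.run_eq (O : OracleFamily l m n) (Q : Circuit l m n N) :
    Q.run O = Q.toMatrix O *ᵥ ketZero N := by
  rw [run]
  generalize ketZero N = ψ
  induction Q generalizing ψ with
  | nil => exact (Matrix.one_mulVec ψ).symm
  | cons op Q ih => rw [List.foldl_cons, ih, toMatrix, Matrix.mulVec_mulVec]

/-- The inverse of an elementary operation. -/
def Op.inv : Op l m n N → Op l m n N
  | .gate k hk e g => .gate k hk e g⁻¹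
  | .query o inverse e => .query o (!inverse) e
  | .cquery o inverse e => .cquery o (!inverse) e

/-- The inverse circuit. -/
def Circuit.inv (Q : Circuit l m n N) : Circuit l m n N := (List.map Op.inv Q).reverse

lemma oracleMatrix_not (O : OracleFamily l m n) (o : Oracle) (inverse : Bool) :
    oracleMatrix O o (!inverse) = (oracleMatrix O o inverse)ᴴ := by
  cases inverse <;> simp [oracleMatrix, Matrix.star_eq_conjTranspose]

lemma oracleMatrix_mem_unitaryGroup (O : OracleFamily l m n) (o : Oracle) (inverse : Bool) :
    oracleMatrix O o inverse ∈ Matrix.unitaryGroup (Fin (o.width l m n) → Bool) ℂ := by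
  unfold oracleMatrix
  split_ifs
  exacts [((O o)⁻¹).2, (O o).2]

lemma Op.toMatrix_mem_unitaryGroup (O : OracleFamily l m n) (op : Op l m n N) :
    op.toMatrix O ∈ Matrix.unitaryGroup (Fin N → Bool) ℂ := by
  cases op with
  | gate k hk e g => exact onQubits_mem_unitaryGroup e g.2
  | query o i e => exact onQubits_mem_unitaryGroup e (oracleMatrix_mem_unitaryGroup O o i)
  | cquery o i e =>
    exact onQubits_mem_unitaryGroup e
      (controlled_mem_unitaryGroup (oracleMatrix_mem_unitaryGroup O o i))

lemma Op.toMatrix_inv (O : OracleFamily l m n) (op : Op l m n N) :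
    op.inv.toMatrix O = (op.toMatrix O)ᴴ := by
  cases op with
  | gate k hk e g => exact (onQubits_conjTranspose e g.val).symm
  | query o i e => rw [inv, toMatrix, toMatrix, onQubits_conjTranspose, oracleMatrix_not]
  | cquery o i e =>
    rw [inv, toMatrix, toMatrix, onQubits_conjTranspose, controlled_conjTranspose,
      oracleMatrix_not]

lemma Circuit.toMatrix_mem_unitaryGroup (O : OracleFamily l m n) (Q : Circuit l m n N) :
    Q.toMatrix O ∈ Matrix.unitaryGroup (Fin N → Bool) ℂ := by
  induction Q with
  | nil => exact one_mem _
  | cons op Q ih => exact mul_mem ih (op.toMatrix_mem_unitaryGroup O)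

lemma Circuit.toMatrix_inv (O : OracleFamily l m n) (Q : Circuit l m n N) :
    Q.inv.toMatrix O = (Q.toMatrix O)ᴴ := by
  induction Q with
  | nil => exact Matrix.conjTranspose_one.symm
  | cons op Q ih =>
    rw [inv, List.map_cons, List.reverse_cons, toMatrix_append, toMatrix_singleton, ← inv, ih,
      toMatrix, Op.toMatrix_inv, Matrix.conjTranspose_mul]

lemma Circuit.length_inv (Q : Circuit l m n N) : List.length Q.inv = List.length Q := by
  rw [inv, List.length_reverse, List.length_map]

/-- The elementary operation `op` on the qubits `f 0, f 1, …` of a larger register. -/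
def Op.lift (f : Fin D ↪ Fin N) : Op l m n D → Op l m n N
  | .gate k hk e g => .gate k hk (e.trans f) g
  | .query o inverse e => .query o inverse (e.trans f)
  | .cquery o inverse e => .cquery o inverse (e.trans f)

/-- The circuit `Q` on the qubits `f 0, f 1, …` of a larger register. -/
def Circuit.lift (f : Fin D ↪ Fin N) (Q : Circuit l m n D) : Circuit l m n N :=
  List.map (Op.lift f) Q

lemma onQubits_trans {k : ℕ} (g : Fin k ↪ Fin D) (f : Fin D ↪ Fin N)
    (U : Matrix (Fin k → Bool) (Fin k → Bool) ℂ) :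
    onQubits (g.trans f) U = onQubits f (onQubits g U) := by
  ext x y
  simp only [onQubits, Matrix.of_apply, Function.Embedding.coe_trans, Function.comp_apply,
    Function.comp_assoc, ← ite_and]
  refine if_congr ⟨fun h => ⟨fun q hq => ?_, fun q hq => ?_⟩, fun ⟨hf, hg⟩ q hq => ?_⟩ rfl rfl
  · exact h q fun t => hq (g t)
  · exact h (f q) fun t => f.injective.ne (hq t)
  · by_cases hqf : ∃ s, f s = q
    · obtain ⟨s, rfl⟩ := hqf
      exact hg s fun t ht => hq t (congrArg f ht)
    · exact hf q (not_exists.mp hqf)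

lemma Circuit.toMatrix_lift (O : OracleFamily l m n) (f : Fin D ↪ Fin N) (Q : Circuit l m n D) :
    (Q.lift f).toMatrix O = onQubits f (Q.toMatrix O) := by
  induction Q with
  | nil => exact (onQubits_one f).symm
  | cons op Q ih =>
    have hop : (op.lift f).toMatrix O = onQubits f (op.toMatrix O) := by
      cases op <;> exact onQubits_trans _ _ _
    rw [toMatrix, onQubits_mul, ← ih, ← hop]
    rfl

/-- The state `ψ` on the qubits `e 0, e 1, …`, with all other qubits in the state `|0⟩`. -/
def padded (e : Fin D ↪ Fin N) (ψ : State D) : State N :=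
  fun x => if ∀ q, (∀ t, e t ≠ q) → x q = false then ψ (x ∘ e) else 0

lemma padded_ketZero (e : Fin D ↪ Fin N) : padded e (ketZero D) = ketZero N := by
  funext x
  have hx := extend_eq_iff e.injective (z := fun _ => false) (x := fun _ => false) (y := x)
  rw [show Function.extend e (fun _ => false) (fun _ => false) = fun _ => false from
    extend_comp_self e.injective _] at hx
  simp only [padded, ketZero, ket, Pi.single_apply, ← ite_and]
  exact if_congr (and_comm.trans (hx.symm.trans eq_comm)) rfl rfl

lemma onQubits_mulVec_padded (e : Fin D ↪ Fin N) (M : Matrix (Fin D → Bool) (Fin D → Bool) ℂ)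
    (ψ : State D) : onQubits e M *ᵥ padded e ψ = padded e (M *ᵥ ψ) := by
  funext x
  have hclean (z : Fin D → Bool) : (∀ q, (∀ t, e t ≠ q) → Function.extend e z x q = false) ↔
      ∀ q, (∀ t, e t ≠ q) → x q = false := by
    obtain ⟨-, hx⟩ := (extend_eq_iff e.injective (z := z) (x := x)).mp rfl
    exact forall₂_congr fun q hq => by rw [hx q hq]
  simp only [onQubits_mulVec, padded, hclean, Function.extend_comp e.injective]
  split_ifs
  · rfl
  · simp only [mul_zero, Finset.sum_const_zero]

/-- The circuit `Q` performs the operator `M` on the qubits `e 0, e 1, …` as long as the other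
qubits, its ancillas, start in the state `|0⟩`; it then returns them in that state. -/
def Circuit.Implements (Q : Circuit l m n N) (O : OracleFamily l m n) (e : Fin D ↪ Fin N)
    (M : Matrix (Fin D → Bool) (Fin D → Bool) ℂ) : Prop :=
  ∀ ψ, Q.toMatrix O *ᵥ padded e ψ = padded e (M *ᵥ ψ)

variable {O : OracleFamily l m n} {e : Fin D ↪ Fin N} {Q Q' : Circuit l m n N}
  {M M' : Matrix (Fin D → Bool) (Fin D → Bool) ℂ}

lemma Circuit.Implements.append (h : Q.Implements O e M) (h' : Q'.Implements O e M') :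
    Circuit.Implements (Q ++ Q') O e (M' * M) := fun ψ => by
  rw [toMatrix_append, ← Matrix.mulVec_mulVec, h, h', Matrix.mulVec_mulVec]

lemma Circuit.Implements.inv (h : Q.Implements O e M)
    (hM : M ∈ Matrix.unitaryGroup (Fin D → Bool) ℂ) : Q.inv.Implements O e Mᴴ := fun ψ => by
  have hQ : (Q.toMatrix O)ᴴ * Q.toMatrix O = 1 :=
    Matrix.mem_unitaryGroup_iff'.mp (Q.toMatrix_mem_unitaryGroup O)
  have hMM : M * Mᴴ = 1 := Matrix.mem_unitaryGroup_iff.mp hM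
  have hψ := h (Mᴴ *ᵥ ψ)
  rw [Matrix.mulVec_mulVec, hMM, Matrix.one_mulVec] at hψ
  rw [toMatrix_inv, ← hψ, Matrix.mulVec_mulVec, hQ, Matrix.one_mulVec]

lemma Circuit.lift_implements (O : OracleFamily l m n) (e : Fin D ↪ Fin N) (Q : Circuit l m n D) :
    (Q.lift e).Implements O e (Q.toMatrix O) := fun ψ => by
  rw [toMatrix_lift, onQubits_mulVec_padded]

end Circuits

/-! ## Fixed-point amplitude amplification -/

section Amplification

variable {ι : Type*} [Fintype ι]

/-- The probability that a measurement of the state `ψ` in the standard basis has its outcome in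
`T`, by the Born rule. -/
def prob (T : Finset ι) (ψ : ι → ℂ) : ℝ := ∑ x ∈ T, ‖ψ x‖ ^ 2

lemma star_dotProduct_self (ψ : ι → ℂ) : star ψ ⬝ᵥ ψ = (prob Finset.univ ψ : ℂ) := by
  rw [prob, dotProduct, Complex.ofReal_sum]
  exact Finset.sum_congr rfl fun x _ => by
    rw [Pi.star_apply, Complex.star_def, Complex.conj_mul', Complex.ofReal_pow]

variable [DecidableEq ι]

/-- The operator that multiplies the amplitudes in `T` by `ω`. -/
def phaseOn (T : Finset ι) (ω : ℂ) : Matrix ι ι ℂ :=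
  Matrix.diagonal fun x => if x ∈ T then ω else 1

lemma prob_add_prob_compl (T : Finset ι) (ψ : ι → ℂ) :
    prob T ψ + prob Tᶜ ψ = prob Finset.univ ψ :=
  Finset.sum_add_sum_compl T _

lemma prob_univ_mulVec {V : Matrix ι ι ℂ} (hV : V ∈ Matrix.unitaryGroup ι ℂ) (ψ : ι → ℂ) :
    prob Finset.univ (V *ᵥ ψ) = prob Finset.univ ψ := by
  rw [← Complex.ofReal_inj, ← star_dotProduct_self, ← star_dotProduct_self, Matrix.star_mulVec,
    ← Matrix.dotProduct_mulVec, Matrix.mulVec_mulVec,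
    show Vᴴ * V = 1 from Matrix.mem_unitaryGroup_iff'.mp hV, Matrix.one_mulVec]

lemma prob_univ_single (x₀ : ι) : prob Finset.univ (Pi.single x₀ (1 : ℂ)) = 1 := by
  rw [← Complex.ofReal_inj, ← star_dotProduct_self, dotProduct_single_one, Pi.star_apply,
    Pi.single_eq_same, star_one, Complex.ofReal_one]

lemma phaseOn_mulVec (T : Finset ι) (ω : ℂ) (ψ : ι → ℂ) (x : ι) :
    (phaseOn T ω *ᵥ ψ) x = (if x ∈ T then ω else 1) * ψ x :=
  Matrix.mulVec_diagonal _ _ _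

lemma phaseOn_singleton_mulVec (x₀ : ι) (ω : ℂ) (ψ : ι → ℂ) :
    phaseOn {x₀} ω *ᵥ ψ = ψ - ((1 - ω) * ψ x₀) • Pi.single x₀ 1 := by
  funext x
  rw [phaseOn_mulVec, Pi.sub_apply, Pi.smul_apply, smul_eq_mul]
  by_cases hx : x = x₀
  · subst hx
    rw [if_pos (Finset.mem_singleton_self x), Pi.single_eq_same]
    ring
  · rw [if_neg (Finset.notMem_singleton.mpr hx), Pi.single_eq_of_ne hx, one_mul, mul_zero, sub_zero]

lemma phaseOn_mem_unitaryGroup (T : Finset ι) (ω : Circle) :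
    phaseOn T ω ∈ Matrix.unitaryGroup ι ℂ := by
  rw [Matrix.mem_unitaryGroup_iff, Matrix.star_eq_conjTranspose, phaseOn,
    Matrix.diagonal_conjTranspose, Matrix.diagonal_mul_diagonal, ← Matrix.diagonal_one]
  congr 1
  funext x
  rw [Pi.star_apply]
  split_ifs
  · rw [Complex.star_def, Complex.mul_conj, Circle.normSq_coe, Complex.ofReal_one]
  · rw [star_one, one_mul]

lemma star_dotProduct_phaseOn_mulVec (T : Finset ι) (ω : ℂ) {ψ : ι → ℂ}
    (hψ : prob Finset.univ ψ = 1) :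
    star ψ ⬝ᵥ (phaseOn T ω *ᵥ ψ) = ω + (1 - ω) * prob Tᶜ ψ := by
  have hT : (prob T ψ : ℂ) = 1 - prob Tᶜ ψ := by
    rw [← Complex.ofReal_one, ← hψ, ← prob_add_prob_compl T ψ]
    push_cast
    ring
  have hsum : star ψ ⬝ᵥ (phaseOn T ω *ᵥ ψ) = ω * prob T ψ + prob Tᶜ ψ := by
    rw [dotProduct, ← Finset.sum_add_sum_compl T, prob, prob, Complex.ofReal_sum,
      Complex.ofReal_sum, Finset.mul_sum]
    refine congrArg₂ (· + ·) (Finset.sum_congr rfl fun x hx => ?_)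
      (Finset.sum_congr rfl fun x hx => ?_)
    · rw [phaseOn_mulVec, if_pos hx, Pi.star_apply, Complex.star_def, mul_left_comm,
        Complex.conj_mul', Complex.ofReal_pow]
    · rw [phaseOn_mulVec, if_neg (Finset.mem_compl.mp hx), Pi.star_apply, Complex.star_def, one_mul,
        Complex.conj_mul', Complex.ofReal_pow]
  rw [hsum, hT]
  ring

lemma amplification_step_apply {V : Matrix ι ι ℂ} (hV : V ∈ Matrix.unitaryGroup ι ℂ) (x₀ : ι)
    (T : Finset ι) {ω : ℂ} (hω : ω ^ 2 = ω - 1) (x : ι) :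
    ((V * phaseOn {x₀} ω * Vᴴ * phaseOn T ω * V) *ᵥ Pi.single x₀ 1) x =
      (if x ∈ T then ω * (1 + prob Tᶜ (V *ᵥ Pi.single x₀ 1)) - 1
        else ω * prob Tᶜ (V *ᵥ Pi.single x₀ 1)) * (V *ᵥ Pi.single x₀ 1) x := by
  set ψ := V *ᵥ Pi.single x₀ (1 : ℂ) with hψ
  set χ := phaseOn T ω *ᵥ ψ with hχ
  have hψ1 : prob Finset.univ ψ = 1 := (prob_univ_mulVec hV _).trans (prob_univ_single x₀)
  have hVV : V * Vᴴ = 1 := Matrix.mem_unitaryGroup_iff.mp hV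
  have hamp : (Vᴴ *ᵥ χ) x₀ = ω + (1 - ω) * prob Tᶜ ψ := by
    have hcol : ψ = V.col x₀ := Matrix.mulVec_single_one V x₀
    rw [← star_dotProduct_phaseOn_mulVec T ω hψ1, ← hχ, hcol]
    rfl
  have hstep : (V * phaseOn {x₀} ω * Vᴴ * phaseOn T ω * V) *ᵥ Pi.single x₀ 1 =
      χ - ((1 - ω) * (ω + (1 - ω) * prob Tᶜ ψ)) • ψ := by
    simp only [← Matrix.mulVec_mulVec, ← hψ, ← hχ]
    rw [phaseOn_singleton_mulVec, hamp, Matrix.mulVec_sub, Matrix.mulVec_smul,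
      Matrix.mulVec_mulVec, hVV, Matrix.one_mulVec]
  rw [hstep, Pi.sub_apply, Pi.smul_apply, smul_eq_mul, hχ, phaseOn_mulVec]
  split_ifs
  · linear_combination (1 - prob Tᶜ ψ) * ψ x * hω
  · linear_combination (1 - prob Tᶜ ψ) * ψ x * hω

/-- The phase factor `exp (i π / 3)` of the fixed-point amplification. -/
def piThird : Circle := Circle.exp (Real.pi / 3)

lemma piThird_sq : (piThird : ℂ) ^ 2 = piThird - 1 := by
  have hval : (piThird : ℂ) = 1 / 2 + √3 / 2 * Complex.I := by
    rw [piThird, Circle.coe_exp, Complex.exp_mul_I, ← Complex.ofReal_cos, ← Complex.ofReal_sin,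
      Real.cos_pi_div_three, Real.sin_pi_div_three]
    push_cast
    rfl
  have h3 : (√3 : ℂ) ^ 2 = 3 := by
    rw [← Complex.ofReal_pow, Real.sq_sqrt zero_le_three, Complex.ofReal_ofNat]
  rw [hval]
  linear_combination (√3 ^ 2 / 4 : ℂ) * Complex.I_sq - h3 / 4

/-- Grover's `π/3` amplification of the amplitudes in `T` of the state that `V` prepares from the
basis state `x₀`, iterated `k` times. -/
def amplify (V : Matrix ι ι ℂ) (x₀ : ι) (T : Finset ι) : ℕ → Matrix ι ι ℂ
  | 0 => V
  | k + 1 => amplify V x₀ T k * phaseOn {x₀} piThird * (amplify V x₀ T k)ᴴ *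
      phaseOn T piThird * amplify V x₀ T k

variable {V : Matrix ι ι ℂ}

lemma amplify_mem_unitaryGroup (hV : V ∈ Matrix.unitaryGroup ι ℂ) (x₀ : ι) (T : Finset ι) (k : ℕ) :
    amplify V x₀ T k ∈ Matrix.unitaryGroup ι ℂ := by
  induction k with
  | zero => exact hV
  | succ k ih =>
    exact mul_mem (mul_mem (mul_mem (mul_mem ih (phaseOn_mem_unitaryGroup _ _))
      (Unitary.star_mem ih)) (phaseOn_mem_unitaryGroup _ _)) ih

lemma exists_amplify_apply_eq (hV : V ∈ Matrix.unitaryGroup ι ℂ) (x₀ : ι) (T : Finset ι) (k : ℕ) :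
    ∃ c : ℂ, ∀ x ∈ T,
      (amplify V x₀ T k *ᵥ Pi.single x₀ 1) x = c * (V *ᵥ Pi.single x₀ 1) x := by
  induction k with
  | zero => exact ⟨1, fun x _ => (one_mul _).symm⟩
  | succ k ih =>
    obtain ⟨c, hc⟩ := ih
    refine ⟨(piThird * (1 + prob Tᶜ (amplify V x₀ T k *ᵥ Pi.single x₀ 1)) - 1) * c,
      fun x hx => ?_⟩
    rw [amplify, amplification_step_apply (amplify_mem_unitaryGroup hV x₀ T k) x₀ T piThird_sq,
      if_pos hx, hc x hx, ← mul_assoc]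

lemma prob_compl_amplify (hV : V ∈ Matrix.unitaryGroup ι ℂ) (x₀ : ι) (T : Finset ι) (k : ℕ) :
    prob Tᶜ (amplify V x₀ T k *ᵥ Pi.single x₀ 1) =
      prob Tᶜ (V *ᵥ Pi.single x₀ 1) ^ 3 ^ k := by
  induction k with
  | zero => exact (pow_one _).symm
  | succ k ih =>
    set δ := prob Tᶜ (amplify V x₀ T k *ᵥ Pi.single x₀ 1) with hδ
    have hstep : ∀ x ∈ Tᶜ, ‖(amplify V x₀ T (k + 1) *ᵥ Pi.single x₀ 1) x‖ ^ 2 =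
        δ ^ 2 * ‖(amplify V x₀ T k *ᵥ Pi.single x₀ 1) x‖ ^ 2 := fun x hx => by
      rw [amplify, amplification_step_apply (amplify_mem_unitaryGroup hV x₀ T k) x₀ T piThird_sq,
        if_neg (Finset.mem_compl.mp hx), norm_mul, norm_mul, Circle.norm_coe, one_mul, mul_pow,
        Complex.norm_real, Real.norm_eq_abs, sq_abs]
    calc prob Tᶜ (amplify V x₀ T (k + 1) *ᵥ Pi.single x₀ 1)
        = δ ^ 2 * δ := by
          rw [hδ, prob, prob, Finset.mul_sum, Finset.sum_congr rfl hstep, hδ, prob]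
      _ = prob Tᶜ (V *ᵥ Pi.single x₀ 1) ^ 3 ^ (k + 1) := by
          rw [ih]
          ring

end Amplification

/-! ## Gates -/

section Gates

variable {l m n N : ℕ}

/-- A `2 × 2` matrix as an operator on a one-qubit register. -/
def oneQubit (V : Matrix Bool Bool ℂ) : Matrix (Fin 1 → Bool) (Fin 1 → Bool) ℂ :=
  V.submatrix (Equiv.funUnique (Fin 1) Bool) (Equiv.funUnique (Fin 1) Bool)

lemma oneQubit_mem_unitaryGroup {V : Matrix Bool Bool ℂ} (hV : V ∈ Matrix.unitaryGroup Bool ℂ) :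
    oneQubit V ∈ Matrix.unitaryGroup (Fin 1 → Bool) ℂ := by
  rw [Matrix.mem_unitaryGroup_iff, Matrix.star_eq_conjTranspose] at hV ⊢
  rw [oneQubit, Matrix.conjTranspose_submatrix, Matrix.submatrix_mul_equiv, hV,
    Matrix.submatrix_one_equiv]

lemma onQubits_oneQubit_mulVec (e : Fin 1 ↪ Fin N) (V : Matrix Bool Bool ℂ) (ψ : State N)
    (x : Fin N → Bool) :
    (onQubits e (oneQubit V) *ᵥ ψ) x =
      ∑ b, V (x (e 0)) b * ψ (Function.update x (e 0) b) := by
  have hext (b : Bool) : Function.extend e ((Equiv.funUnique (Fin 1) Bool).symm b) x =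
      Function.update x (e 0) b := by
    refine (extend_eq_iff e.injective).mpr ⟨?_, fun q hq => Function.update_of_ne (hq 0).symm _ _⟩
    funext t
    rw [Subsingleton.elim t 0]
    exact Function.update_self _ _ _
  rw [onQubits_mulVec, ← (Equiv.funUnique (Fin 1) Bool).symm.sum_comp]
  refine Finset.sum_congr rfl fun b _ => ?_
  rw [hext, oneQubit, Matrix.submatrix_apply, Equiv.apply_symm_apply]
  rfl

/-- The one-qubit gate `V` on the qubit `a`, controlled by the qubit `c`; the junk value for
`c = a` is the empty circuit. -/
def controlledGate (V : Matrix.unitaryGroup Bool ℂ) (c a : Fin N) : Circuit l m n N :=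
  if h : c ≠ a then
    [Op.gate 2 le_rfl (Function.Embedding.embFinTwo h)
      ⟨controlled (oneQubit V.val), controlled_mem_unitaryGroup (oneQubit_mem_unitaryGroup V.2)⟩]
  else []

lemma length_controlledGate_le (V : Matrix.unitaryGroup Bool ℂ) (c a : Fin N) :
    List.length (controlledGate V c a : Circuit l m n N) ≤ 1 := by
  unfold controlledGate
  split_ifs
  exacts [le_rfl, zero_le_one]

lemma controlledGate_mulVec (O : OracleFamily l m n) (V : Matrix.unitaryGroup Bool ℂ)
    {c a : Fin N} (h : c ≠ a) (ψ : State N) (x : Fin N → Bool) :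
    ((controlledGate V c a).toMatrix O *ᵥ ψ) x =
      if x c = true then ∑ b, V.val (x a) b * ψ (Function.update x a b) else ψ x := by
  rw [controlledGate, dif_pos h, Circuit.toMatrix_singleton, Op.toMatrix,
    onQubits_controlled_mulVec, onQubits_oneQubit_mulVec]
  rfl

/-- The NOT gate. -/
def notGate : Matrix.unitaryGroup Bool ℂ :=
  ⟨Matrix.of fun a b => if a = b then 0 else 1, by
    rw [Matrix.mem_unitaryGroup_iff]
    ext a b
    rw [Matrix.mul_apply, Fintype.sum_bool]
    cases a <;> cases b <;> simp [Matrix.star_apply]⟩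

/-- The square root of the NOT gate. -/
def sqrtNotGate : Matrix.unitaryGroup Bool ℂ :=
  ⟨Matrix.of fun a b => if a = b then (1 + Complex.I) / 2 else (1 - Complex.I) / 2, by
    rw [Matrix.mem_unitaryGroup_iff]
    ext a b
    rw [Matrix.mul_apply, Fintype.sum_bool]
    cases a <;> cases b <;> apply Complex.ext <;>
      simp [Matrix.star_apply] <;> norm_num⟩

lemma controlledNot_mulVec (O : OracleFamily l m n) {c a : Fin N} (h : c ≠ a) (ψ : State N)
    (x : Fin N → Bool) :
    ((controlledGate notGate c a).toMatrix O *ᵥ ψ) x = ψ (Function.update x a (x a ^^ x c)) := by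
  have hx := Function.update_eq_self a x
  rw [controlledGate_mulVec O _ h, Fintype.sum_bool]
  cases ha : x a <;> rw [ha] at hx <;> cases hc : x c <;> simp [notGate, hx]

lemma controlledSqrtNot_mulVec (O : OracleFamily l m n) {c a : Fin N} (h : c ≠ a) (ψ : State N)
    (x : Fin N → Bool) :
    ((controlledGate sqrtNotGate c a).toMatrix O *ᵥ ψ) x =
      if x c = true then (1 + Complex.I) / 2 * ψ x
        + (1 - Complex.I) / 2 * ψ (Function.update x a (!x a)) else ψ x := by
  have hx := Function.update_eq_self a x
  rw [controlledGate_mulVec O _ h, Fintype.sum_bool]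
  cases ha : x a <;> rw [ha] at hx <;> simp [sqrtNotGate, hx, add_comm]

/-- The reversible OR: it flips the qubit `a` if one of the qubits `c` and `p` is set. The number
of roots of NOT that it applies to `a` is `c + p + (c xor p) = 2 (c or p)`. -/
def orGate (c p a : Fin N) : Circuit l m n N :=
  controlledGate sqrtNotGate c a ++ controlledGate sqrtNotGate p a ++ controlledGate notGate c p ++
    controlledGate sqrtNotGate p a ++ controlledGate notGate c p

lemma length_orGate_le (c p a : Fin N) : List.length (orGate c p a : Circuit l m n N) ≤ 5 := by
  have h1 := length_controlledGate_le (l := l) (m := m) (n := n) sqrtNotGate c a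
  have h2 := length_controlledGate_le (l := l) (m := m) (n := n) sqrtNotGate p a
  have h3 := length_controlledGate_le (l := l) (m := m) (n := n) notGate c p
  simp only [orGate, List.length_append]
  omega

lemma orGate_mulVec (O : OracleFamily l m n) {c p a : Fin N} (hcp : c ≠ p) (hca : c ≠ a)
    (hpa : p ≠ a) (ψ : State N) (x : Fin N → Bool) :
    ((orGate c p a).toMatrix O *ᵥ ψ) x = ψ (Function.update x a (x a ^^ (x c || x p))) := by
  have hax := Function.update_eq_self a x
  have hpx := Function.update_eq_self p x
  have hu (b : Bool) : Function.update (Function.update x a b) p (x p) = Function.update x a b := by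
    rw [Function.update_comm hpa.symm, hpx]
  have hroot (u v : ℂ) : (1 + Complex.I) / 2 * ((1 + Complex.I) / 2 * u + (1 - Complex.I) / 2 * v)
      + (1 - Complex.I) / 2 * ((1 + Complex.I) / 2 * v + (1 - Complex.I) / 2 * u) = v := by
    linear_combination (u - v) / 2 * Complex.I_sq
  simp only [orGate, Circuit.toMatrix_append, ← Matrix.mulVec_mulVec, controlledNot_mulVec O hcp,
    controlledSqrtNot_mulVec O hca, controlledSqrtNot_mulVec O hpa, Function.update_self,
    Function.update_of_ne hcp, Function.update_of_ne hca, Function.update_of_ne hpa.symm,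
    Function.update_comm hpa, Function.update_idem]
  cases ha : x a <;> rw [ha] at hax <;> cases hp : x p <;> rw [hp] at hpx hu <;>
    cases hc : x c <;> simp [hax, hpx, hu, hroot]

/-- The diagonal gate that multiplies by `ω` if its qubit is not set. -/
def phaseGate (ω : Circle) : Matrix.unitaryGroup (Fin 1 → Bool) ℂ :=
  ⟨oneQubit (phaseOn {false} ω), oneQubit_mem_unitaryGroup (phaseOn_mem_unitaryGroup _ ω)⟩

/-- A circuit that multiplies by `ω` if neither the qubit `p` nor any control, the first entry of
a pair in the list, is set. The second entries are ancillas: the OR of `p` and the controls is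
accumulated along them, and is uncomputed after the phase. -/
def zeroPhase (ω : Circle) : Fin N → List (Fin N × Fin N) → Circuit l m n N
  | p, [] => [Op.gate 1 one_le_two ⟨fun _ => p, Function.injective_of_subsingleton _⟩ (phaseGate ω)]
  | p, (c, a) :: L => orGate c p a ++ zeroPhase ω a L ++ orGate c p a

lemma length_zeroPhase_le (ω : Circle) (p : Fin N) (L : List (Fin N × Fin N)) :
    List.length (zeroPhase ω p L : Circuit l m n N) ≤ 10 * L.length + 1 := by
  induction L generalizing p with
  | nil => exact le_rfl
  | cons ca L ih =>
    have h1 := ih ca.2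
    have h2 := length_orGate_le (l := l) (m := m) (n := n) ca.1 p ca.2
    rw [zeroPhase, List.length_append, List.length_append, List.length_cons]
    omega

/-- The phase that `zeroPhase` applies to the basis state `x`. -/
def zeroPhaseFactor (ω : Circle) : Fin N → List (Fin N × Fin N) → (Fin N → Bool) → ℂ
  | p, [], x => if x p = false then ω else 1
  | p, (c, a) :: L, x => zeroPhaseFactor ω a L (Function.update x a (x a ^^ (x c || x p)))

lemma zeroPhase_mulVec (O : OracleFamily l m n) (ω : Circle) {p : Fin N}
    {L : List (Fin N × Fin N)} (hL : (p :: L.map Prod.snd).Nodup)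
    (hc : ∀ u ∈ L, u.1 ∉ p :: L.map Prod.snd) (ψ : State N) (x : Fin N → Bool) :
    ((zeroPhase ω p L).toMatrix O *ᵥ ψ) x = zeroPhaseFactor ω p L x * ψ x := by
  induction L generalizing p ψ x with
  | nil =>
    rw [zeroPhase, Circuit.toMatrix_singleton, Op.toMatrix, phaseGate, onQubits_oneQubit_mulVec,
      zeroPhaseFactor]
    have hx := Function.update_eq_self p x
    cases hp : x p <;> rw [hp] at hx <;> simp [phaseOn, hx]
  | cons ca L ih =>
    obtain ⟨c, a⟩ := ca
    simp only [List.map_cons, List.forall_mem_cons] at hL hc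
    rw [List.nodup_cons, List.mem_cons, not_or] at hL
    simp only [List.mem_cons, not_or] at hc
    obtain ⟨⟨hpa, -⟩, hLa⟩ := hL
    obtain ⟨⟨hcp, hca, -⟩, hc⟩ := hc
    simp only [zeroPhase, Circuit.toMatrix_append, ← Matrix.mulVec_mulVec]
    rw [orGate_mulVec O hcp hca hpa, ih hLa fun u hu => by simpa using (hc u hu).2,
      orGate_mulVec O hcp hca hpa, zeroPhaseFactor]
    simp [Function.update_of_ne hca, Function.update_of_ne hpa]

lemma zeroPhaseFactor_eq (ω : Circle) {p : Fin N} {L : List (Fin N × Fin N)}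
    (hL : (p :: L.map Prod.snd).Nodup) (hc : ∀ u ∈ L, u.1 ∉ p :: L.map Prod.snd)
    {x : Fin N → Bool} (hx : ∀ u ∈ L, x u.2 = false) :
    zeroPhaseFactor ω p L x = if x p = false ∧ ∀ u ∈ L, x u.1 = false then (ω : ℂ) else 1 := by
  induction L generalizing p x with
  | nil => simp [zeroPhaseFactor]
  | cons ca L ih =>
    obtain ⟨c, a⟩ := ca
    simp only [List.map_cons, List.forall_mem_cons] at hL hc hx
    rw [List.nodup_cons] at hL
    have hLa := List.nodup_cons.mp hL.2
    have hc' (u) (hu : u ∈ L) : u.1 ∉ a :: L.map Prod.snd :=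
      fun h => hc.2 u hu (List.mem_cons_of_mem _ h)
    have hne (u) (hu : u ∈ L) : u.2 ≠ a :=
      fun h => hLa.1 (h ▸ List.mem_map_of_mem hu)
    have hne' (u) (hu : u ∈ L) : u.1 ≠ a := fun h => hc' u hu (h ▸ List.mem_cons_self)
    rw [zeroPhaseFactor,
      ih hL.2 hc' fun u hu => by rw [Function.update_of_ne (hne u hu), hx.2 u hu]]
    refine if_congr ?_ rfl rfl
    rw [Function.update_self, hx.1, Bool.false_xor, Bool.or_eq_false_iff, List.forall_mem_cons,
      forall₂_congr fun u hu => by rw [Function.update_of_ne (hne' u hu)]]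
    tauto

end Gates

/-! ## Amplification by a circuit -/

section AmplifyCircuit

variable {l m n D N : ℕ}

/-- The basis states in which all qubits of `S` are `0`. -/
def zeroSet (S : Finset (Fin D)) : Finset (Fin D → Bool) := {x | ∀ s ∈ S, x s = false}

lemma zeroSet_univ : zeroSet (Finset.univ : Finset (Fin D)) = {fun _ => false} := by
  ext x
  simp only [zeroSet, Finset.mem_univ, true_imp_iff, Finset.mem_filter, true_and,
    Finset.mem_singleton, funext_iff]

/-- A circuit that multiplies by `ω` if all qubits `d s` with `s ∈ S` are `0`; the qubits `anc`
are its ancillas. -/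
def phaseOnZero (ω : Circle) (d : Fin D ↪ Fin N) (anc : Fin (D + 1) ↪ Fin N) (S : Finset (Fin D)) :
    Circuit l m n N :=
  zeroPhase ω (anc 0) (S.toList.map fun s => (d s, anc s.succ))

lemma length_phaseOnZero_le (ω : Circle) (d : Fin D ↪ Fin N) (anc : Fin (D + 1) ↪ Fin N)
    (S : Finset (Fin D)) :
    List.length (phaseOnZero ω d anc S : Circuit l m n N) ≤ 10 * D + 1 := by
  have h := length_zeroPhase_le (l := l) (m := m) (n := n) ω (anc 0)
    (S.toList.map fun s => (d s, anc s.succ))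
  rw [List.length_map, Finset.length_toList] at h
  exact h.trans (by gcongr; simpa using S.card_le_univ)

lemma phaseOnZero_implements (O : OracleFamily l m n) (ω : Circle) {d : Fin D ↪ Fin N}
    {anc : Fin (D + 1) ↪ Fin N} (hda : ∀ s t, d s ≠ anc t) (S : Finset (Fin D)) :
    (phaseOnZero ω d anc S).Implements O d (phaseOn (zeroSet S) ω) := by
  set L := S.toList.map fun s => (d s, anc s.succ)
  have hflags : L.map Prod.snd = S.toList.map fun s => anc s.succ := by
    rw [List.map_map]
    rfl
  have hnodup : (anc 0 :: L.map Prod.snd).Nodup := by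
    rw [hflags, List.nodup_cons]
    refine ⟨fun h => ?_, S.nodup_toList.map (anc.injective.comp (Fin.succ_injective D))⟩
    obtain ⟨s, -, hs⟩ := List.mem_map.mp h
    exact Fin.succ_ne_zero s (anc.injective hs)
  have hcontrols : ∀ u ∈ L, u.1 ∉ anc 0 :: L.map Prod.snd := by
    rw [hflags]
    refine List.forall_mem_map.mpr fun s _ => List.not_mem_cons_of_ne_of_not_mem (hda s 0) ?_
    rw [List.mem_map]
    exact fun ⟨t, _, ht⟩ => hda s t.succ ht.symm
  intro ψ
  funext x
  rw [phaseOnZero, zeroPhase_mulVec O ω hnodup hcontrols]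
  by_cases hx : ∀ q, (∀ t, d t ≠ q) → x q = false
  · have hanc (t) : x (anc t) = false := hx _ fun s => hda s t
    rw [zeroPhaseFactor_eq ω hnodup hcontrols (List.forall_mem_map.mpr fun s _ => hanc _), padded,
      padded, if_pos hx, if_pos hx, phaseOn_mulVec]
    refine congrArg (· * _) (if_congr ?_ rfl rfl)
    simp only [hanc, L, List.forall_mem_map, Finset.mem_toList, true_and, zeroSet,
      Finset.mem_filter, Finset.mem_univ, Function.comp_apply]
  · rw [padded, padded, if_neg hx, if_neg hx, mul_zero]

/-- The circuit for `amplify`: it amplifies, in the state that `W` prepares on the qubits `d` from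
the zero state, the basis states in which all qubits of `S` are `0`. -/
def amplifyCircuit (d : Fin D ↪ Fin N) (anc : Fin (D + 1) ↪ Fin N) (W : Circuit l m n D)
    (S : Finset (Fin D)) : ℕ → Circuit l m n N
  | 0 => W.lift d
  | k + 1 => amplifyCircuit d anc W S k ++ phaseOnZero piThird d anc S ++
      (amplifyCircuit d anc W S k).inv ++ phaseOnZero piThird d anc Finset.univ ++
      amplifyCircuit d anc W S k

lemma amplifyCircuit_implements (O : OracleFamily l m n) {d : Fin D ↪ Fin N}
    {anc : Fin (D + 1) ↪ Fin N} (hda : ∀ s t, d s ≠ anc t) (W : Circuit l m n D)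
    (S : Finset (Fin D)) (k : ℕ) :
    (amplifyCircuit d anc W S k).Implements O d
      (amplify (W.toMatrix O) (fun _ => false) (zeroSet S) k) := by
  induction k with
  | zero => exact W.lift_implements O d
  | succ k ih =>
    have hV := amplify_mem_unitaryGroup (W.toMatrix_mem_unitaryGroup O) (fun _ => false)
      (zeroSet S) k
    have hzero := phaseOnZero_implements O piThird hda Finset.univ
    rw [zeroSet_univ] at hzero
    rw [amplify]
    simpa only [amplifyCircuit, mul_assoc] using
      (((ih.append (phaseOnZero_implements O piThird hda S)).append (ih.inv hV)).append
        hzero).append ih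

lemma length_amplifyCircuit_le (d : Fin D ↪ Fin N) (anc : Fin (D + 1) ↪ Fin N)
    (W : Circuit l m n D) (S : Finset (Fin D)) (k : ℕ) :
    List.length (amplifyCircuit d anc W S k) ≤ 3 ^ k * (List.length W + (10 * D + 1)) := by
  suffices h : List.length (amplifyCircuit d anc W S k) + (10 * D + 1) ≤
      3 ^ k * (List.length W + (10 * D + 1)) by omega
  induction k with
  | zero => rw [amplifyCircuit, Circuit.lift, List.length_map, pow_zero, one_mul]
  | succ k ih =>
    have hS := length_phaseOnZero_le (l := l) (m := m) (n := n) piThird d anc S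
    have hz := length_phaseOnZero_le (l := l) (m := m) (n := n) piThird d anc Finset.univ
    simp only [amplifyCircuit, List.length_append, Circuit.length_inv]
    rw [pow_succ]
    linarith

end AmplifyCircuit

section OutputRegister

variable {l m n a w : ℕ}

/-- The basis states of `a + w` qubits in which the last `w` qubits, the work qubits, are `0`. -/
def workZero (a w : ℕ) : Finset (Fin (a + w) → Bool) := zeroSet (Finset.univ.map (Fin.natAddEmb a))

lemma State.norm_sq (ψ : State a) : ψ.norm ^ 2 = prob Finset.univ ψ :=
  EuclideanSpace.norm_sq_eq _

lemma State.norm_eq_one {ψ : State a} (hψ : prob Finset.univ ψ = 1) : ψ.norm = 1 :=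
  (pow_eq_one_iff_of_nonneg (norm_nonneg _) two_ne_zero).mp (ψ.norm_sq.trans hψ)

lemma State.norm_ketZero : State.norm (ketZero w) = 1 := State.norm_eq_one (prob_univ_single _)

lemma append_mem_workZero (y : Fin a → Bool) :
    Fin.append y (fun _ => false) ∈ workZero a w := by
  simp [workZero, zeroSet]

lemma prob_workZero (ψ : State (a + w)) :
    prob (workZero a w) ψ = ∑ y, ‖ψ (Fin.append y fun _ => false)‖ ^ 2 := by
  symm
  refine Finset.sum_nbij' (fun y => Fin.append y fun _ => false) (fun x => x ∘ Fin.castAdd w)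
    (fun y _ => append_mem_workZero y) (fun _ _ => Finset.mem_univ _) (fun y _ => ?_)
    (fun x hx => ?_) fun _ _ => rfl
  · funext i
    exact Fin.append_left _ _ i
  · simp only [workZero, zeroSet, Finset.mem_filter, Finset.mem_univ, true_and, Finset.mem_map,
      forall_exists_index, forall_apply_eq_imp_iff] at hx
    refine funext fun q => Fin.addCases (fun i => ?_) (fun j => ?_) q
    · exact Fin.append_left _ _ i
    · exact (Fin.append_right _ _ j).trans (hx j).symm

lemma prob_workZero_of_eq_mul {φ : State a} (hφ : prob Finset.univ φ = 1) {ψ : State (a + w)}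
    {c : ℂ} (h : ∀ y, ψ (Fin.append y fun _ => false) = c * φ y) :
    prob (workZero a w) ψ = ‖c‖ ^ 2 := by
  simp only [prob_workZero, h, norm_mul, mul_pow, ← Finset.mul_sum]
  rw [← prob, hφ, mul_one]

/-- The work qubits are left in `|0…0⟩`, up to the phase of `c`. -/
lemma exists_norm_sub_tensor_sq_le {φ : State a} (hφ : prob Finset.univ φ = 1)
    {ψ : State (a + w)} (hψ : prob Finset.univ ψ = 1) {c : ℂ}
    (h : ∀ y, ψ (Fin.append y fun _ => false) = c * φ y) :
    ∃ χ : State w, χ.norm = 1 ∧ State.norm (ψ - tensor φ χ) ^ 2 ≤ 2 * (1 - ‖c‖ ^ 2) := by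
  obtain ⟨γ, hγ, hcγ⟩ : ∃ γ : ℂ, ‖γ‖ = 1 ∧ c = ‖c‖ * γ :=
    ⟨_, Complex.norm_exp_ofReal_mul_I _, (Complex.norm_mul_exp_arg_mul_I c).symm⟩
  have hc : ‖c‖ ^ 2 = 1 - prob (workZero a w)ᶜ ψ := by
    rw [← prob_workZero_of_eq_mul hφ h, ← hψ, ← prob_add_prob_compl (workZero a w) ψ,
      add_sub_cancel_right]
  have hzero : prob (workZero a w) (ψ - tensor φ (γ • ketZero w)) = (1 - ‖c‖) ^ 2 := by
    have hdist : ‖c - γ‖ = |1 - ‖c‖| := by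
      rw [show c - γ = ((‖c‖ - 1 : ℝ) : ℂ) * γ by rw [Complex.ofReal_sub, sub_mul, ← hcγ]; simp,
        norm_mul, hγ, mul_one, Complex.norm_real, Real.norm_eq_abs, abs_sub_comm]
    rw [← sq_abs (1 - ‖c‖), ← hdist]
    refine prob_workZero_of_eq_mul hφ fun y => ?_
    simp only [Pi.sub_apply, h, tensor, Fin.append_left, Fin.append_right, ketZero, ket,
      Pi.smul_apply, Pi.single_eq_same, smul_eq_mul, mul_one]
    ring
  have hcompl : prob (workZero a w)ᶜ (ψ - tensor φ (γ • ketZero w)) =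
      prob (workZero a w)ᶜ ψ := by
    refine Finset.sum_congr rfl fun x hx => ?_
    have hx' : (fun j => x (Fin.natAdd a j)) ≠ fun _ => false := by
      simpa [workZero, zeroSet, funext_iff] using hx
    rw [Pi.sub_apply, tensor, ketZero, ket, Pi.smul_apply, Pi.single_eq_of_ne hx', smul_zero,
      mul_zero, sub_zero]
  refine ⟨γ • ketZero w, ?_, ?_⟩
  · rw [State.norm, WithLp.toLp_smul, norm_smul, hγ, one_mul, ← State.norm, State.norm_ketZero]
  · rw [State.norm_sq, ← prob_add_prob_compl (workZero a w), hzero, hcompl]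
    have hc_le : ‖c‖ ≤ 1 := by
      rw [← sq_le_one_iff₀ (norm_nonneg c), hc, sub_le_self_iff]
      exact Finset.sum_nonneg fun _ _ => sq_nonneg _
    nlinarith [norm_nonneg c]

/-- The circuit `W` followed by rounds of amplification of the basis states whose work qubits are
`0`. The work qubits of `W` are followed by the ancillas of the rounds. -/
def amplifyOutput (W : Circuit l m n (a + w)) (k : ℕ) : Circuit l m n (a + (w + (a + w + 1))) :=
  amplifyCircuit (Fin.castLEEmb (by omega)) ((Fin.natAddEmb w).trans (Fin.natAddEmb a)) W
    (Finset.univ.map (Fin.natAddEmb a)) k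

lemma length_amplifyOutput_le (W : Circuit l m n (a + w)) (k : ℕ) :
    List.length (amplifyOutput W k) ≤ 3 ^ k * (List.length W + (10 * (a + w) + 1)) :=
  length_amplifyCircuit_le _ _ _ _ _

lemma toMatrix_amplifyOutput_apply (O : OracleFamily l m n) (W : Circuit l m n (a + w)) (k : ℕ)
    (y : Fin a → Bool) :
    ((amplifyOutput W k).toMatrix O *ᵥ ketZero _) (Fin.append y fun _ => false) =
      (amplify (W.toMatrix O) (fun _ => false) (workZero a w) k *ᵥ ketZero _)
        (Fin.append y fun _ => false) := by
  rw [amplifyOutput, ← padded_ketZero (Fin.castLEEmb (by omega) : Fin (a + w) ↪ _),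
    amplifyCircuit_implements, padded, if_pos]
  · refine congrArg _ (funext fun q => Fin.addCases (fun i => ?_) (fun j => ?_) q)
    · exact (Fin.append_left _ _ i).trans (Fin.append_left _ _ i).symm
    · exact (Fin.append_right y _ (Fin.castAdd _ j)).trans
        (Fin.append_right y (fun _ => false) j).symm
  · refine fun q hq => Fin.addCases (fun i hi => ?_) (fun j _ => Fin.append_right _ _ j) q hq
    exact absurd rfl (hi (Fin.castAdd w i))
  · exact fun s t h => absurd (congrArg Fin.val h) (by simp; omega)

lemma amplifyOutput_obtains (O : OracleFamily l m n) {W : Circuit l m n (a + w)} {φ : State a}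
    (hφ : prob Finset.univ φ = 1) {s : ℂ}
    (hW : ∀ y, (W.toMatrix O *ᵥ ketZero _) (Fin.append y fun _ => false) = s * φ y) {k : ℕ} {ε : ℝ}
    (hε : 0 ≤ ε) (hk : 2 * (1 - ‖s‖ ^ 2) ^ 3 ^ k ≤ ε ^ 2) : (amplifyOutput W k).Obtains O φ ε := by
  have hWU := W.toMatrix_mem_unitaryGroup O
  set V := amplify (W.toMatrix O) (fun _ => false) (workZero a w) k
  have hV : prob Finset.univ (V *ᵥ ketZero _) = 1 :=
    (prob_univ_mulVec (amplify_mem_unitaryGroup hWU _ _ _) _).trans (prob_univ_single _)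
  have hQ : prob Finset.univ ((amplifyOutput W k).toMatrix O *ᵥ ketZero _) = 1 :=
    (prob_univ_mulVec (Circuit.toMatrix_mem_unitaryGroup O _) _).trans (prob_univ_single _)
  obtain ⟨c, hc⟩ := exists_amplify_apply_eq hWU (fun _ => false) (workZero a w) k
  have hVφ (y) : (V *ᵥ ketZero _) (Fin.append y fun _ => false) = c * s * φ y := by
    rw [mul_assoc, ← hW]
    exact hc _ (append_mem_workZero y)
  have hprob : ‖c * s‖ ^ 2 = 1 - (1 - ‖s‖ ^ 2) ^ 3 ^ k := by
    have hs : ‖s‖ ^ 2 + prob (workZero a w)ᶜ (W.toMatrix O *ᵥ ketZero _) = 1 := by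
      rw [← prob_workZero_of_eq_mul hφ hW, prob_add_prob_compl, prob_univ_mulVec hWU]
      exact prob_univ_single _
    rw [← prob_workZero_of_eq_mul hφ hVφ, ← eq_sub_of_add_eq' hs]
    refine eq_sub_of_add_eq (Eq.trans (congrArg _ ?_) ((prob_add_prob_compl _ _).trans hV))
    exact (prob_compl_amplify hWU _ _ k).symm
  obtain ⟨χ, hχ, hdist⟩ := exists_norm_sub_tensor_sq_le hφ hQ fun y =>
    (toMatrix_amplifyOutput_apply O W k y).trans (hVφ y)
  rw [hprob, sub_sub_cancel] at hdist
  refine ⟨χ, hχ, ?_⟩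
  rw [Circuit.run_eq]
  exact abs_le_of_sq_le_sq' (hdist.trans hk) hε |>.2

end OutputRegister

/-! ## The states of vectors and matrices -/

section Encodings

variable {l m n d : ℕ}

/-- The binary digits of an index, as a basis state of its register. -/
def bits (k : Fin d) : Fin (qubits d) → Bool := fun t => Nat.testBit k.val t.val

lemma idx_eq_ket_bits (k : Fin d) : idx k = ket (bits k) := rfl

lemma bits_injective : Function.Injective (bits : Fin d → Fin (qubits d) → Bool) := by
  intro i j h
  refine Fin.ext (Nat.eq_of_testBit_eq fun t => ?_)
  by_cases ht : t < qubits d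
  · exact congrFun h ⟨t, ht⟩
  · have hd : d ≤ 2 ^ t :=
      (Nat.le_pow_clog one_lt_two d).trans (Nat.pow_le_pow_right two_pos (not_lt.mp ht))
    rw [Nat.testBit_eq_false_of_lt (i.2.trans_le hd), Nat.testBit_eq_false_of_lt (j.2.trans_le hd)]

lemma tensor_append {a b : ℕ} (ψ : State a) (φ : State b) (y : Fin a → Bool) (z : Fin b → Bool) :
    tensor ψ φ (Fin.append y z) = ψ y * φ z := by
  simp only [tensor, Fin.append_left, Fin.append_right]

lemma append_eq_append_iff {a b : ℕ} {y y' : Fin a → Bool} {z z' : Fin b → Bool} :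
    Fin.append y z = Fin.append y' z' ↔ y = y' ∧ z = z' :=
  ((Fin.appendEquiv a b).injective.eq_iff (a := (y, z)) (b := (y', z'))).trans Prod.mk_inj

lemma tensor_ket {a b : ℕ} (y : Fin a → Bool) (z : Fin b → Bool) :
    tensor (ket y) (ket z) = ket (Fin.append y z) := by
  funext x
  obtain ⟨⟨y', z'⟩, rfl⟩ := (Fin.appendEquiv a b).surjective x
  refine (tensor_append _ _ y' z').trans ?_
  simp only [ket, Pi.single_apply, Fin.appendEquiv, Equiv.coe_fn_mk, append_eq_append_iff,
    ite_zero_mul_ite_zero, mul_one]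

lemma sum_append {a b : ℕ} {M : Type*} [AddCommMonoid M] (f : (Fin (a + b) → Bool) → M) :
    ∑ x, f x = ∑ y : Fin a → Bool, ∑ z : Fin b → Bool, f (Fin.append y z) := by
  rw [← (Fin.appendEquiv a b).sum_comp, Fintype.sum_prod_type]
  rfl

lemma prob_univ_tensor {a b : ℕ} (ψ : State a) (φ : State b) :
    prob Finset.univ (tensor ψ φ) = prob Finset.univ ψ * prob Finset.univ φ := by
  simp only [prob, sum_append, tensor_append, norm_mul, mul_pow, ← Finset.mul_sum,
    ← Finset.sum_mul]

lemma sum_smul_ket {ι : Type*} [Fintype ι] {N : ℕ} {b : ι → Fin N → Bool}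
    (hb : Function.Injective b) (c : ι → ℂ) : ∑ i, c i • ket (b i) = Function.extend b c 0 := by
  funext x
  simp only [Finset.sum_apply, Pi.smul_apply, ket, Pi.single_apply, smul_eq_mul, mul_ite, mul_one,
    mul_zero]
  by_cases hx : ∃ i, b i = x
  · obtain ⟨i, rfl⟩ := hx
    rw [hb.extend_apply, Fintype.sum_eq_single i fun j hj => if_neg (hb.ne hj.symm), if_pos rfl]
  · rw [Function.extend_apply' _ _ _ hx]
    exact Finset.sum_eq_zero fun i _ => if_neg fun h => hx ⟨i, h.symm⟩

lemma vecState_eq_extend (v : Fin d → ℝ) :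
    vecState v = Function.extend bits (fun k => ((v k / vecNorm v : ℝ) : ℂ)) 0 :=
  sum_smul_ket bits_injective _

lemma append_bits_injective : Function.Injective
    fun p : Fin l × Fin n => Fin.append (bits p.1) (bits p.2) := fun _ _ h =>
  have h' := append_eq_append_iff.mp h
  Prod.ext (bits_injective h'.1) (bits_injective h'.2)

lemma matState_eq_extend (M : Matrix (Fin l) (Fin n) ℝ) :
    matState M = Function.extend (fun p : Fin l × Fin n => Fin.append (bits p.1) (bits p.2))
      (fun p => ((M p.1 p.2 / ‖M‖ : ℝ) : ℂ)) 0 := by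
  rw [← sum_smul_ket append_bits_injective, Fintype.sum_prod_type]
  simp only [← tensor_ket]
  rfl

lemma vecState_bits (v : Fin d → ℝ) (k : Fin d) :
    vecState v (bits k) = ((v k / vecNorm v : ℝ) : ℂ) := by
  rw [vecState_eq_extend, bits_injective.extend_apply]

lemma vecState_of_notMem_range (v : Fin d → ℝ) {y : Fin (qubits d) → Bool}
    (hy : y ∉ Set.range bits) : vecState v y = 0 := by
  rw [vecState_eq_extend, Function.extend_apply' _ _ _ hy, Pi.zero_apply]

lemma star_vecState (v : Fin d → ℝ) (y : Fin (qubits d) → Bool) :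
    star (vecState v y) = vecState v y := by
  rw [vecState_eq_extend, Function.apply_extend star]
  congr 1
  · exact funext fun k => Complex.conj_ofReal _
  · exact star_zero _

lemma matState_append_bits_bits (M : Matrix (Fin l) (Fin n) ℝ) (i : Fin l) (j : Fin n) :
    matState M (Fin.append (bits i) (bits j)) = ((M i j / ‖M‖ : ℝ) : ℂ) := by
  rw [matState_eq_extend]
  exact append_bits_injective.extend_apply _ _ (i, j)

lemma matState_append_of_notMem_range_left (M : Matrix (Fin l) (Fin n) ℝ)
    {y : Fin (qubits l) → Bool} (hy : y ∉ Set.range bits) (z : Fin (qubits n) → Bool) :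
    matState M (Fin.append y z) = 0 := by
  rw [matState_eq_extend, Function.extend_apply', Pi.zero_apply]
  exact fun ⟨p, hp⟩ => hy ⟨p.1, (append_eq_append_iff.mp hp).1⟩

lemma matState_append_of_notMem_range_right (M : Matrix (Fin l) (Fin n) ℝ)
    (y : Fin (qubits l) → Bool) {z : Fin (qubits n) → Bool} (hz : z ∉ Set.range bits) :
    matState M (Fin.append y z) = 0 := by
  rw [matState_eq_extend, Function.extend_apply', Pi.zero_apply]
  exact fun ⟨p, hp⟩ => hz ⟨p.2, (append_eq_append_iff.mp hp).2⟩

lemma star_matState (M : Matrix (Fin l) (Fin n) ℝ) (x : Fin (qubits l + qubits n) → Bool) :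
    star (matState M x) = matState M x := by
  rw [matState_eq_extend, Function.apply_extend star]
  congr 1
  · exact funext fun k => Complex.conj_ofReal _
  · exact star_zero _

lemma vecNorm_sq (v : Fin d → ℝ) : vecNorm v ^ 2 = ∑ k, v k ^ 2 :=
  EuclideanSpace.real_norm_sq_eq _

lemma vecNorm_eq_zero {v : Fin d → ℝ} : vecNorm v = 0 ↔ v = 0 := by
  rw [vecNorm, norm_eq_zero, WithLp.toLp_eq_zero]

lemma frobenius_norm_sq (M : Matrix (Fin l) (Fin n) ℝ) : ‖M‖ ^ 2 = ∑ i, ∑ j, M i j ^ 2 := by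
  rw [Matrix.frobenius_norm_def, ← Real.sqrt_eq_rpow, Real.sq_sqrt (by positivity)]
  simp only [Real.norm_eq_abs, Real.rpow_ofNat, sq_abs]

lemma vecNorm_rowNorms (M : Matrix (Fin l) (Fin n) ℝ) : vecNorm (rowNorms M) = ‖M‖ := by
  refine (sq_eq_sq₀ (norm_nonneg _) (norm_nonneg _)).mp ?_
  rw [← vecNorm, vecNorm_sq, frobenius_norm_sq]
  exact Finset.sum_congr rfl fun i _ => vecNorm_sq _

lemma prob_univ_matState {M : Matrix (Fin l) (Fin n) ℝ} (hM : M ≠ 0) :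
    prob Finset.univ (matState M) = 1 := by
  have hsum : ∑ p : Fin l × Fin n, (M p.1 p.2 / ‖M‖) ^ 2 = 1 := by
    simp only [Fintype.sum_prod_type, div_pow, ← Finset.sum_div]
    rw [← frobenius_norm_sq, div_self (pow_ne_zero _ (norm_ne_zero_iff.mpr hM))]
  rw [← hsum]
  refine (Fintype.sum_of_injective _ append_bits_injective _ _ (fun x hx => ?_) fun p => ?_).symm
  · rw [matState_eq_extend, Function.extend_apply' _ _ _ hx, Pi.zero_apply, norm_zero,
      zero_pow two_ne_zero]
  · rw [matState_append_bits_bits, Complex.norm_real, Real.norm_eq_abs, sq_abs]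

lemma rowNorms_mul_vecState (M : Matrix (Fin l) (Fin n) ℝ) (i : Fin l)
    (z : Fin (qubits n) → Bool) :
    vecState (rowNorms M) (bits i) * vecState (M i) z = matState M (Fin.append (bits i) z) := by
  by_cases hz : z ∈ Set.range bits
  · obtain ⟨j, rfl⟩ := hz
    have hrow (h : vecNorm (M i) = 0) : M i j / ‖M‖ = 0 := by
      rw [congrFun (vecNorm_eq_zero.mp h) j, Pi.zero_apply, zero_div]
    rw [vecState_bits, vecState_bits, matState_append_bits_bits, vecNorm_rowNorms, rowNorms,
      ← Complex.ofReal_mul, div_mul_div_comm, mul_comm ‖M‖, ← div_mul_div_comm,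
      div_mul_eq_mul_div, mul_div_cancel_left_of_imp hrow]
  · rw [vecState_of_notMem_range _ hz, matState_append_of_notMem_range_right _ _ hz, mul_zero]

/-- On the padding indices and on the zero rows the entries of `U` are arbitrary, but there the
amplitude of the state of the row norms vanishes. -/
lemma vecState_rowNorms_mul_apply {M : Matrix (Fin l) (Fin n) ℝ}
    {U : Matrix (Fin (qubits l + qubits n) → Bool) (Fin (qubits l + qubits n) → Bool) ℂ}
    (hU : ∀ i, M i ≠ 0 →
      U *ᵥ tensor (idx i) (ketZero (qubits n)) = tensor (idx i) (vecState (M i)))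
    (y y' : Fin (qubits l) → Bool) (z : Fin (qubits n) → Bool) :
    vecState (rowNorms M) y * U (Fin.append y' z) (Fin.append y fun _ => false) =
      if y = y' then matState M (Fin.append y z) else 0 := by
  by_cases hy : y ∈ Set.range bits
  · obtain ⟨i, rfl⟩ := hy
    by_cases hi : M i = 0
    · rw [← rowNorms_mul_vecState, vecState_bits, rowNorms, vecNorm_eq_zero.mpr hi, zero_div,
        Complex.ofReal_zero, zero_mul, zero_mul, ite_self]
    · have h := congrFun (hU i hi) (Fin.append y' z)
      rw [idx_eq_ket_bits, ketZero, tensor_ket, ket, Matrix.mulVec_single_one, Matrix.col_apply,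
        tensor_append, ket, Pi.single_apply] at h
      rw [← rowNorms_mul_vecState, h]
      simp only [eq_comm (a := y'), ite_mul, one_mul, zero_mul, mul_ite, mul_zero]
  · rw [vecState_of_notMem_range _ hy, matState_append_of_notMem_range_left _ hy, zero_mul,
      ite_self]

lemma sum_matState_mul_matState_transpose {A : Matrix (Fin l) (Fin m) ℝ}
    {B : Matrix (Fin m) (Fin n) ℝ} (hAB : A * B ≠ 0) (y : Fin (qubits l) → Bool)
    (z : Fin (qubits n) → Bool) :
    ∑ k, matState A (Fin.append y k) * matState Bᵀ (Fin.append z k) =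
      ((‖A * B‖ / (‖A‖ * ‖B‖) : ℝ) : ℂ) * matState (A * B) (Fin.append y z) := by
  by_cases hy : y ∈ Set.range bits
  · by_cases hz : z ∈ Set.range bits
    · obtain ⟨i, rfl⟩ := hy
      obtain ⟨j, rfl⟩ := hz
      have hsum : ∑ k, A i k / ‖A‖ * (Bᵀ j k / ‖Bᵀ‖) =
          ‖A * B‖ / (‖A‖ * ‖B‖) * ((A * B) i j / ‖A * B‖) := by
        have hnorm := norm_ne_zero_iff.mpr hAB
        simp only [div_mul_div_comm, Matrix.frobenius_norm_transpose, Matrix.transpose_apply]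
        rw [← Finset.sum_div, ← Matrix.mul_apply, mul_comm (‖A‖ * ‖B‖) ‖A * B‖,
          mul_div_mul_left _ _ hnorm]
      rw [matState_append_bits_bits, ← Complex.ofReal_mul, ← hsum, Complex.ofReal_sum]
      symm
      refine Fintype.sum_of_injective bits bits_injective _ _ (fun k hk => ?_) fun k => ?_
      · rw [matState_append_of_notMem_range_right _ _ hk, zero_mul]
      · rw [matState_append_bits_bits, matState_append_bits_bits, ← Complex.ofReal_mul]
    · rw [matState_append_of_notMem_range_right _ _ hz, mul_zero]
      exact Finset.sum_eq_zero fun k _ => by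
        rw [matState_append_of_notMem_range_left _ hz, mul_zero]
  · rw [matState_append_of_notMem_range_left _ hy, mul_zero]
    exact Finset.sum_eq_zero fun k _ => by
      rw [matState_append_of_notMem_range_left _ hy, zero_mul]

end Encodings

/-! ## The product state before amplification -/

section CopyBits

variable {l m n k N : ℕ}

/-- The circuit of CNOTs that adds the bits `e t` to the bits `f t`. -/
def copyBits (e f : Fin k ↪ Fin N) : Circuit l m n N :=
  (List.finRange k).flatMap fun t => controlledGate notGate (e t) (f t)

lemma length_copyBits_le (e f : Fin k ↪ Fin N) :
    List.length (copyBits e f : Circuit l m n N) ≤ k := by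
  have h := List.sum_le_card_nsmul
    ((List.finRange k).map fun t =>
      List.length (controlledGate notGate (e t) (f t) : Circuit l m n N)) 1
    (List.forall_mem_map.mpr fun t _ => length_controlledGate_le _ _ _)
  rw [List.length_map, List.length_finRange, smul_eq_mul, mul_one] at h
  rwa [copyBits, List.length_flatMap]

lemma copyBits_mulVec (O : OracleFamily l m n) {e f : Fin k ↪ Fin N} (hef : ∀ s t, e s ≠ f t)
    (ψ : State N) (x : Fin N → Bool) :
    ((copyBits e f).toMatrix O *ᵥ ψ) x =
      ψ (Function.extend f (fun t => x (f t) ^^ x (e t)) x) := by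
  suffices h : ∀ L : List (Fin k), L.Nodup → ∀ ψ : State N,
      (Circuit.toMatrix O (L.flatMap fun t => controlledGate notGate (e t) (f t)) *ᵥ ψ) x =
        ψ (Function.extend f (fun t => if t ∈ L then x (f t) ^^ x (e t) else x (f t)) x) by
    simpa only [copyBits, List.mem_finRange, if_true] using h _ (List.nodup_finRange k) ψ
  intro L hL
  induction L with
  | nil =>
    intro ψ
    simp only [List.not_mem_nil, if_false, List.flatMap_nil]
    rw [show (fun t => x (f t)) = x ∘ f from rfl, extend_comp_self f.injective]
    exact congrFun (Matrix.one_mulVec ψ) x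
  | cons t L ih =>
    intro ψ
    obtain ⟨ht, hL⟩ := List.nodup_cons.mp hL
    rw [List.flatMap_cons, Circuit.toMatrix_append, ← Matrix.mulVec_mulVec, ih hL,
      controlledNot_mulVec O (hef t t), f.injective.extend_apply, if_neg ht,
      Function.extend_apply' _ _ _ fun ⟨s, hs⟩ => hef t s hs.symm]
    refine congrArg ψ ((extend_eq_iff f.injective).mpr ⟨funext fun s => ?_, fun q hq => ?_⟩).symm
    · by_cases hs : s = t
      · subst hs
        simp
      · simp [f.injective.ne hs, hs, f.injective.extend_apply]
    · rw [Function.update_of_ne (hq t).symm, Function.extend_apply' _ _ _ fun ⟨s, hs⟩ => hq s hs]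

end CopyBits

section Registers

variable {a b p : ℕ}

/-- The register of the row index of the product. -/
def rowReg (a b p : ℕ) : Fin a ↪ Fin (a + b + (b + p)) :=
  (Fin.castAddEmb b).trans (Fin.castAddEmb (b + p))

/-- The register of the column index of the product. -/
def colReg (a b p : ℕ) : Fin b ↪ Fin (a + b + (b + p)) :=
  (Fin.natAddEmb a).trans (Fin.castAddEmb (b + p))

/-- The register of a copy of the column index. -/
def copyReg (a b p : ℕ) : Fin b ↪ Fin (a + b + (b + p)) :=
  (Fin.castAddEmb p).trans (Fin.natAddEmb (a + b))

/-- The register of the summation index. -/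
def sumReg (a b p : ℕ) : Fin p ↪ Fin (a + b + (b + p)) :=
  (Fin.natAddEmb b).trans (Fin.natAddEmb (a + b))

/-- The registers of the row index and of the summation index. -/
def rowSumReg (a b p : ℕ) : Fin (a + p) ↪ Fin (a + b + (b + p)) :=
  Fin.Embedding.append (x := rowReg a b p) (y := sumReg a b p) <|
    Set.disjoint_range_iff.mpr fun i j h => by
      have := congrArg Fin.val h
      simp [rowReg, sumReg] at this
      omega

/-- The registers of the copy of the column index and of the summation index. -/
def copySumReg (a b p : ℕ) : Fin (b + p) ↪ Fin (a + b + (b + p)) := Fin.natAddEmb (a + b)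

lemma colReg_ne_copyReg (s t : Fin b) : colReg a b p s ≠ copyReg a b p t := fun h => by
  have := congrArg Fin.val h
  simp [colReg, copyReg] at this
  omega

lemma forall_register {P : Fin (a + b + (b + p)) → Prop} (hrow : ∀ i, P (rowReg a b p i))
    (hcol : ∀ j, P (colReg a b p j)) (hcopy : ∀ j, P (copyReg a b p j))
    (hsum : ∀ k, P (sumReg a b p k)) (q) : P q :=
  Fin.addCases (Fin.addCases hrow hcol) (Fin.addCases hcopy hsum) q

variable (u u' : Fin a → Bool) (v v' k k' : Fin b → Bool) (z z' : Fin p → Bool)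

/-- The assignment of values to the four registers. -/
def pack : Fin (a + b + (b + p)) → Bool := Fin.append (Fin.append u v) (Fin.append k z)

lemma pack_rowReg (i : Fin a) : pack u v k z (rowReg a b p i) = u i :=
  (Fin.append_left _ _ _).trans (Fin.append_left _ _ _)

lemma pack_colReg (j : Fin b) : pack u v k z (colReg a b p j) = v j :=
  (Fin.append_left _ _ _).trans (Fin.append_right _ _ _)

lemma pack_copyReg (j : Fin b) : pack u v k z (copyReg a b p j) = k j :=
  (Fin.append_right _ _ _).trans (Fin.append_left _ _ _)

lemma pack_sumReg (i : Fin p) : pack u v k z (sumReg a b p i) = z i :=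
  (Fin.append_right _ _ _).trans (Fin.append_right _ _ _)

lemma rowSumReg_castAdd (i : Fin a) : rowSumReg a b p (Fin.castAdd p i) = rowReg a b p i :=
  Fin.append_left _ _ _

lemma rowSumReg_natAdd (i : Fin p) : rowSumReg a b p (Fin.natAdd a i) = sumReg a b p i :=
  Fin.append_right _ _ _

lemma pack_comp_rowSumReg : pack u v k z ∘ rowSumReg a b p = Fin.append u z := by
  refine funext (Fin.addCases (fun i => ?_) fun i => ?_)
  · rw [Function.comp_apply, rowSumReg_castAdd, pack_rowReg, Fin.append_left]
  · rw [Function.comp_apply, rowSumReg_natAdd, pack_sumReg, Fin.append_right]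

lemma extend_rowReg_pack : Function.extend (rowReg a b p) u' (pack u v k z) = pack u' v k z := by
  refine (extend_eq_iff (rowReg a b p).injective).mpr ⟨funext (pack_rowReg _ _ _ _),
    forall_register (fun i h => absurd rfl (h i)) ?_ ?_ ?_⟩ <;> intro _ _
  · simp only [pack_colReg]
  · simp only [pack_copyReg]
  · simp only [pack_sumReg]

lemma extend_colReg_pack : Function.extend (colReg a b p) v' (pack u v k z) = pack u v' k z := by
  refine (extend_eq_iff (colReg a b p).injective).mpr ⟨funext (pack_colReg _ _ _ _),
    forall_register ?_ (fun j h => absurd rfl (h j)) ?_ ?_⟩ <;> intro _ _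
  · simp only [pack_rowReg]
  · simp only [pack_copyReg]
  · simp only [pack_sumReg]

lemma extend_copyReg_pack : Function.extend (copyReg a b p) k' (pack u v k z) = pack u v k' z := by
  refine (extend_eq_iff (copyReg a b p).injective).mpr ⟨funext (pack_copyReg _ _ _ _),
    forall_register ?_ ?_ (fun j h => absurd rfl (h j)) ?_⟩ <;> intro _ _
  · simp only [pack_rowReg]
  · simp only [pack_colReg]
  · simp only [pack_sumReg]

lemma extend_rowSumReg_pack :
    Function.extend (rowSumReg a b p) (Fin.append u' z') (pack u v k z) = pack u' v k z' := by
  refine (extend_eq_iff (rowSumReg a b p).injective).mpr ⟨pack_comp_rowSumReg _ _ _ _,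
    forall_register (fun i h => absurd (rowSumReg_castAdd i) (h _)) ?_ ?_
      fun i h => absurd (rowSumReg_natAdd i) (h _)⟩ <;> intro _ _
  · simp only [pack_colReg]
  · simp only [pack_copyReg]

lemma extend_copySumReg_pack :
    Function.extend (copySumReg a b p) (Fin.append k' z') (pack u v k z) = pack u v k' z' := by
  refine (extend_eq_iff (copySumReg a b p).injective).mpr ⟨funext (Fin.append_right _ _),
    forall_register ?_ ?_ (fun j h => absurd rfl (h (Fin.castAdd p j)))
      fun i h => absurd rfl (h (Fin.natAdd b i))⟩ <;> intro _ _
  · simp only [pack_rowReg]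
  · simp only [pack_colReg]

variable (ψ : State (a + b + (b + p)))

lemma onQubits_rowReg_mulVec_pack (U : Matrix (Fin a → Bool) (Fin a → Bool) ℂ) :
    (onQubits (rowReg a b p) U *ᵥ ψ) (pack u v k z) = ∑ u', U u u' * ψ (pack u' v k z) := by
  rw [onQubits_mulVec, show pack u v k z ∘ rowReg a b p = u from funext (pack_rowReg u v k z)]
  simp only [extend_rowReg_pack]

lemma onQubits_colReg_mulVec_pack (U : Matrix (Fin b → Bool) (Fin b → Bool) ℂ) :
    (onQubits (colReg a b p) U *ᵥ ψ) (pack u v k z) = ∑ v', U v v' * ψ (pack u v' k z) := by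
  rw [onQubits_mulVec, show pack u v k z ∘ colReg a b p = v from funext (pack_colReg u v k z)]
  simp only [extend_colReg_pack]

lemma onQubits_rowSumReg_mulVec_pack
    (U : Matrix (Fin (a + p) → Bool) (Fin (a + p) → Bool) ℂ) :
    (onQubits (rowSumReg a b p) U *ᵥ ψ) (pack u v k z) =
      ∑ u', ∑ z', U (Fin.append u z) (Fin.append u' z') * ψ (pack u' v k z') := by
  rw [onQubits_mulVec, pack_comp_rowSumReg, sum_append]
  simp only [extend_rowSumReg_pack]

lemma onQubits_copySumReg_mulVec_pack
    (U : Matrix (Fin (b + p) → Bool) (Fin (b + p) → Bool) ℂ) :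
    (onQubits (copySumReg a b p) U *ᵥ ψ) (pack u v k z) =
      ∑ k', ∑ z', U (Fin.append k z) (Fin.append k' z') * ψ (pack u v k' z') := by
  rw [onQubits_mulVec, sum_append,
    show pack u v k z ∘ copySumReg a b p = Fin.append k z from funext (Fin.append_right _ _)]
  simp only [extend_copySumReg_pack]

lemma copyBits_mulVec_pack {l m n : ℕ} (O : OracleFamily l m n) :
    ((copyBits (colReg a b p) (copyReg a b p)).toMatrix O *ᵥ ψ) (pack u v k z) =
      ψ (pack u v (fun j => k j ^^ v j) z) := by
  simp only [copyBits_mulVec O colReg_ne_copyReg, pack_copyReg, pack_colReg, extend_copyReg_pack]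

lemma append_const {α : Type*} (a b : ℕ) (c : α) :
    Fin.append (fun _ : Fin a => c) (fun _ : Fin b => c) = fun _ => c :=
  funext (Fin.addCases (Fin.append_left _ _) (Fin.append_right _ _))

lemma ketZero_pack : ketZero (a + b + (b + p)) (pack u v k z) =
    ketZero a u * ketZero b v * (ketZero b k * ketZero p z) := by
  have h (c d : ℕ) : ketZero (c + d) = tensor (ketZero c) (ketZero d) := by
    rw [ketZero, ketZero, ketZero, tensor_ket, append_const]
  rw [pack, h, tensor_append, h, tensor_append, h, tensor_append]

end Registers

section ProductCircuit

variable {l m n : ℕ}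

/-- The queries that prepare the state of `A` and that of the column norms of `B`. -/
def queryCircuit (l m n : ℕ) : Circuit l m n (qubits l + qubits n + (qubits n + qubits m)) :=
  [.query .normA false (rowReg _ _ _)] ++ [.query .normB false (colReg _ _ _)] ++
    [.query .rowA false (rowSumReg _ _ _)]

/-- The circuit that prepares the state of `A * B`, with amplitude `‖A * B‖ / (‖A‖ * ‖B‖)`, on the
basis states whose last two registers are `0`. Nothing is known about the column oracle on other
indices than those of nonzero columns. It therefore acts on a copy of the column index: the index
register keeps the state of the column norms, which vanishes on all other indices. -/
def productCircuit (l m n : ℕ) : Circuit l m n (qubits l + qubits n + (qubits n + qubits m)) :=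
  queryCircuit l m n ++ copyBits (colReg (qubits l) (qubits n) (qubits m)) (copyReg _ _ _) ++
    [.query .colB true (copySumReg _ _ _)] ++
    copyBits (colReg (qubits l) (qubits n) (qubits m)) (copyReg _ _ _)

lemma length_productCircuit_le (l m n : ℕ) :
    List.length (productCircuit l m n) ≤ 4 + 2 * qubits n := by
  have h := length_copyBits_le (l := l) (m := m) (n := n)
    (colReg (qubits l) (qubits n) (qubits m)) (copyReg _ _ _)
  simp only [productCircuit, queryCircuit, List.length_append, List.length_cons, List.length_nil]
  omega

variable {O : OracleFamily l m n} {A : Matrix (Fin l) (Fin m) ℝ} {B : Matrix (Fin m) (Fin n) ℝ}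

lemma queryCircuit_mulVec_ketZero (hO : Prepares O A B) (u : Fin (qubits l) → Bool)
    (v k : Fin (qubits n) → Bool) (z : Fin (qubits m) → Bool) :
    ((queryCircuit l m n).toMatrix O *ᵥ ketZero _) (pack u v k z) =
      matState A (Fin.append u z) * (vecState (colNorms B) v * ketZero _ k) := by
  simp only [queryCircuit, Circuit.toMatrix_append, Circuit.toMatrix_singleton, Op.toMatrix,
    oracleMatrix, Bool.false_eq_true, if_false, ← Matrix.mulVec_mulVec]
  set χ := onQubits (rowReg _ _ _) (O .normA).val *ᵥ
    ketZero (qubits l + qubits n + (qubits n + qubits m)) with hχ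
  have hA (u v k z) : χ (pack u v k z) =
      vecState (rowNorms A) u * (ketZero _ v * (ketZero _ k * ketZero _ z)) := by
    simp only [hχ, onQubits_rowReg_mulVec_pack, ketZero_pack, ← hO.normA, mul_assoc]
    simp only [← mul_assoc, ← Finset.sum_mul]
    rfl
  have hB (u v k z) : (onQubits (colReg _ _ _) (O .normB).val *ᵥ χ) (pack u v k z) =
      vecState (rowNorms A) u * (vecState (colNorms B) v * (ketZero _ k * ketZero _ z)) := by
    simp only [onQubits_colReg_mulVec_pack, hA, ← hO.normB,
      mul_left_comm _ (vecState (rowNorms A) u), ← Finset.mul_sum]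
    simp only [← mul_assoc, ← Finset.sum_mul]
    rfl
  have hrow (u') : vecState (rowNorms A) u' *
      (O .rowA).val (Fin.append u z) (Fin.append u' fun _ => false) =
        if u' = u then matState A (Fin.append u' z) else 0 :=
    vecState_rowNorms_mul_apply hO.rowA u' u z
  calc _ = ∑ u', vecState (rowNorms A) u' *
        (O .rowA).val (Fin.append u z) (Fin.append u' fun _ => false) *
          (vecState (colNorms B) v * ketZero _ k) := by
        rw [onQubits_rowSumReg_mulVec_pack]
        refine Fintype.sum_congr _ _ fun u' => ?_
        rw [Fintype.sum_eq_single fun _ => false]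
        · rw [hB, show ketZero (qubits m) (fun _ => false) = 1 from Pi.single_eq_same _ _]
          ring
        · intro z' hz
          rw [hB, show ketZero (qubits m) z' = 0 from Pi.single_eq_of_ne hz _]
          ring
    _ = _ := by simp only [hrow, ite_mul, zero_mul, Finset.sum_ite_eq', Finset.mem_univ, if_true]

lemma productCircuit_mulVec_ketZero (hO : Prepares O A B) (hAB : A * B ≠ 0)
    (x : Fin (qubits l + qubits n) → Bool) :
    ((productCircuit l m n).toMatrix O *ᵥ ketZero _) (Fin.append x fun _ => false) =
      ((‖A * B‖ / (‖A‖ * ‖B‖) : ℝ) : ℂ) * matState (A * B) x := by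
  obtain ⟨⟨u, v⟩, rfl⟩ := (Fin.appendEquiv _ _).surjective x
  have hpack : (Fin.append (Fin.append u v) fun _ => false) =
      pack u v (fun _ : Fin (qubits n) => false) fun _ : Fin (qubits m) => false := by
    rw [pack, append_const]
  have hcol (z) : star ((O .colB).val (Fin.append v z) (Fin.append v fun _ => false)) *
      vecState (colNorms B) v = matState Bᵀ (Fin.append v z) := by
    have h := congrArg star (vecState_rowNorms_mul_apply hO.colB v v z)
    rwa [if_pos rfl, star_matState, star_mul, star_vecState] at h
  have hcopy (k : Fin (qubits n) → Bool) : ketZero _ (fun j => k j ^^ v j) =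
      if k = v then 1 else 0 := by
    simp [ketZero, ket, Pi.single_apply, funext_iff]
  refine Eq.trans ?_ (sum_matState_mul_matState_transpose hAB u v)
  rw [show Fin.appendEquiv _ _ (u, v) = Fin.append u v from rfl, hpack, productCircuit]
  simp only [Circuit.toMatrix_append, Circuit.toMatrix_singleton, Op.toMatrix,
    ← Matrix.mulVec_mulVec, copyBits_mulVec_pack, Bool.false_xor]
  rw [show oracleMatrix O .colB true = (O .colB).valᴴ from oracleMatrix_not O .colB false,
    onQubits_copySumReg_mulVec_pack]
  simp only [copyBits_mulVec_pack, queryCircuit_mulVec_ketZero hO, hcopy,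
    Matrix.conjTranspose_apply, ← hcol]
  rw [Fintype.sum_eq_single v fun k hk => Finset.sum_eq_zero fun z _ => by simp [hk]]
  exact Fintype.sum_congr _ _ fun z => by rw [if_pos rfl]; ring

end ProductCircuit

/-! ## Running time and accuracy -/

section Bounds

variable {l m n : ℕ}

lemma qubits_le_one_add_two_mul_log (d : ℕ) : (qubits d : ℝ) ≤ 1 + 2 * Real.log d := by
  obtain rfl | hd := d.eq_zero_or_pos
  · simp
  have hlog : 0 ≤ Real.log d := Real.log_natCast_nonneg d
  have hlogb : Real.logb 2 d ≤ 2 * Real.log d := by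
    rw [Real.logb, div_le_iff₀ (Real.log_pos one_lt_two)]
    nlinarith [Real.log_two_gt_d9]
  have hceil := Nat.ceil_lt_add_one (Real.logb_nonneg one_lt_two (Nat.one_le_cast.mpr hd))
  rw [show ⌈Real.logb 2 d⌉₊ = qubits d by exact_mod_cast Real.natCeil_logb_natCast 2 d] at hceil
  linarith

lemma log_two_add_nonneg (l m n : ℕ) {ε R : ℝ} (hε : 0 < ε) (hR : 0 ≤ R) :
    0 ≤ Real.log (2 + l * m * n * R / ε) :=
  Real.log_nonneg (by linarith [show 0 ≤ l * m * n * R / ε by positivity])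

lemma one_add_qubits_le (hl : 0 < l) (hm : 0 < m) (hn : 0 < n) {ε R : ℝ} (hε : 0 < ε)
    (hε_lt : ε < 2) (hR : 1 ≤ R) :
    1 + qubits l + qubits m + qubits n ≤ 12 * Real.log (2 + l * m * n * R / ε) := by
  have hl' : (0 : ℝ) < l := Nat.cast_pos.mpr hl
  have hm' : (0 : ℝ) < m := Nat.cast_pos.mpr hm
  have hn' : (0 : ℝ) < n := Nat.cast_pos.mpr hn
  have hlog : Real.log (l * m * n) = Real.log l + Real.log m + Real.log n := by
    rw [Real.log_mul (by positivity) hn'.ne', Real.log_mul hl'.ne' hm'.ne']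
  set P : ℝ := l * m * n
  have hP : 0 < P := by positivity
  have hhalf : P / 2 ≤ P * R / ε := by
    rw [div_le_div_iff₀ two_pos hε]
    nlinarith
  have htwo : Real.log 2 ≤ Real.log (2 + P * R / ε) := Real.log_le_log two_pos (by linarith)
  have hlogP : Real.log P ≤ 2 * Real.log (2 + P * R / ε) := by
    rw [← Nat.cast_two, ← Real.log_pow]
    exact Real.log_le_log hP (by push_cast; nlinarith)
  linarith [qubits_le_one_add_two_mul_log l, qubits_le_one_add_two_mul_log m,
    qubits_le_one_add_two_mul_log n, Real.log_two_gt_d9]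

lemma one_sub_pow_le_sq {p δ : ℝ} {M : ℕ} (hp : p ≤ 1) (hδ : 0 < δ)
    (hM : 2 * Real.log δ⁻¹ ≤ p * M) : (1 - p) ^ M ≤ δ ^ 2 :=
  calc (1 - p) ^ M ≤ Real.exp (-p) ^ M :=
        pow_le_pow_left₀ (sub_nonneg.mpr hp) (Real.one_sub_le_exp_neg p) M
    _ = Real.exp (-(p * M)) := by rw [← Real.exp_nat_mul, mul_neg, mul_comm]
    _ ≤ Real.exp ((2 : ℕ) * Real.log δ) := by
        rw [Real.log_inv] at hM
        exact Real.exp_le_exp.mpr (by push_cast; linarith)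
    _ = δ ^ 2 := by rw [Real.exp_nat_mul, Real.exp_log hδ]

lemma pos_of_mul_ne_zero {A : Matrix (Fin l) (Fin m) ℝ} {B : Matrix (Fin m) (Fin n) ℝ}
    (hAB : A * B ≠ 0) : 0 < l ∧ 0 < m ∧ 0 < n := by
  obtain ⟨i, j, hij⟩ : ∃ i j, (A * B) i j ≠ 0 := by
    contrapose! hAB
    exact Matrix.ext hAB
  obtain ⟨k, -, -⟩ := Finset.exists_ne_zero_of_sum_ne_zero (Matrix.mul_apply (M := A) ▸ hij)
  exact ⟨i.pos, k.pos, j.pos⟩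

lemma length_amplifyOutput_productCircuit_le (l m n k : ℕ) :
    List.length (amplifyOutput (productCircuit l m n) k) ≤
      3 ^ k * (22 * (1 + qubits l + qubits m + qubits n)) := by
  refine (length_amplifyOutput_le _ _).trans (Nat.mul_le_mul_left _ ?_)
  have := length_productCircuit_le l m n
  omega

lemma amplifyOutput_productCircuit_obtains {A : Matrix (Fin l) (Fin m) ℝ}
    {B : Matrix (Fin m) (Fin n) ℝ} {O : OracleFamily l m n} {k : ℕ} {ε R : ℝ} (hε : 0 < ε)
    (hR : 0 < R) (hk : 2 * R ^ 2 * Real.log (4 / ε) ≤ 3 ^ k) (hAB : A * B ≠ 0)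
    (hABR : ‖A‖ * ‖B‖ / ‖A * B‖ ≤ R) (hO : Prepares O A B) :
    (amplifyOutput (productCircuit l m n) k).Obtains O (matState (A * B)) ε := by
  set s := ‖A * B‖ / (‖A‖ * ‖B‖) with hs
  have hnorm : ‖A * B‖ ≤ ‖A‖ * ‖B‖ := Matrix.frobenius_norm_mul A B
  have hs_le : s ≤ 1 := div_le_one_of_le₀ hnorm (by positivity)
  have hs_ge : R⁻¹ ≤ s := by
    have hpos := norm_pos_iff.mpr hAB
    rw [hs, ← inv_div]
    exact inv_anti₀ (div_pos (hpos.trans_le hnorm) hpos) hABR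
  refine amplifyOutput_obtains O (prob_univ_matState hAB)
    (productCircuit_mulVec_ketZero hO hAB) hε.le ?_
  have hpow : (1 - s ^ 2) ^ 3 ^ k ≤ (ε / 4) ^ 2 := by
    refine one_sub_pow_le_sq (pow_le_one₀ (by positivity) hs_le) (by positivity) ?_
    calc 2 * Real.log (ε / 4)⁻¹ = R⁻¹ ^ 2 * (2 * R ^ 2 * Real.log (4 / ε)) := by
          rw [inv_div]
          field_simp
      _ ≤ R⁻¹ ^ 2 * 3 ^ k := by gcongr
      _ ≤ s ^ 2 * (3 ^ k : ℕ) := by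
          push_cast
          gcongr
  rw [Complex.norm_real, Real.norm_of_nonneg (by positivity)]
  nlinarith

lemma obtains_nil {a : ℕ} (O : OracleFamily l m n) {φ : State a} (hφ : prob Finset.univ φ = 1)
    {ε : ℝ} (hε : 2 ≤ ε) : Circuit.Obtains (w := 0) [] O φ ε := by
  refine ⟨ketZero 0, State.norm_ketZero, (norm_sub_le (WithLp.toLp 2 _) (WithLp.toLp 2 _)).trans ?_⟩
  have htensor : State.norm (tensor φ (ketZero 0)) = 1 :=
    State.norm_eq_one (by rw [prob_univ_tensor, hφ, one_mul]; exact prob_univ_single _)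
  exact (add_le_add State.norm_ketZero.le htensor.le).trans (by linarith)

end Bounds

end QMatMul

end

open QMatMul in
theorem mainTheorem4_general :
    ∃ K : ℕ, ∀ (l m n : ℕ) (ε R : ℝ), 0 < ε → 1 ≤ R →
      ∃ (w : ℕ) (Q : Circuit l m n ((qubits l + qubits n) + w)),
        (Q.time : ℝ) ≤
          K * (R ^ 2 * Real.posLog (4 / ε)) * Real.log (2 + l * m * n * R / ε) ∧
        ∀ (A : Matrix (Fin l) (Fin m) ℝ) (B : Matrix (Fin m) (Fin n) ℝ)
          (O : OracleFamily l m n),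
          A * B ≠ 0 → ‖A‖ * ‖B‖ / ‖A * B‖ ≤ R → Prepares O A B →
          Q.Obtains O (matState (A * B)) ε := by
  refine ⟨1584, fun l m n ε R hε hR => ?_⟩
  by_cases h : (0 < l ∧ 0 < m ∧ 0 < n) ∧ ε < 2
  · obtain ⟨⟨hl, hm, hn⟩, hε_lt⟩ := h
    have hlog : 1 / 2 ≤ Real.log (4 / ε) := by
      have := Real.log_le_log two_pos ((le_div_iff₀ hε).mpr (by linarith : 2 * ε ≤ 4))
      linarith [Real.log_two_gt_d9]
    obtain ⟨k, hk, hk'⟩ := exists_nat_pow_near (x := 2 * R ^ 2 * Real.log (4 / ε)) (y := 3)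
      (by nlinarith) (by norm_num)
    refine ⟨_, amplifyOutput (productCircuit l m n) (k + 1), ?_, fun A B O hAB hABR hO =>
      amplifyOutput_productCircuit_obtains hε (by positivity) hk'.le hAB hABR hO⟩
    rw [Real.posLog_apply, max_eq_right (by linarith)]
    calc _ ≤ (3 * 3 ^ k * (22 * (1 + qubits l + qubits m + qubits n)) : ℝ) := by
          rw [← pow_succ']
          exact_mod_cast length_amplifyOutput_productCircuit_le l m n (k + 1)
      _ ≤ 3 * (2 * R ^ 2 * Real.log (4 / ε)) *
          (22 * (12 * Real.log (2 + l * m * n * R / ε))) := by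
        gcongr
        exact one_add_qubits_le hl hm hn hε hε_lt hR
      _ = _ := by push_cast; ring
  · refine ⟨0, [], ?_, fun A B O hAB _ _ => obtains_nil O (prob_univ_matState hAB) ?_⟩
    · have hlog := log_two_add_nonneg l m n hε (by positivity : 0 ≤ R)
      have hposLog : 0 ≤ Real.posLog (4 / ε) := Real.posLog_nonneg
      rw [Circuit.time, List.length_nil, Nat.cast_zero]
      positivity
    · contrapose! h
      exact ⟨pos_of_mul_ne_zero hAB, h⟩

open QMatMul in
theorem mainTheorem4 :
    ∃ K c : ℕ, ∀ (l m n : ℕ) (ε R : ℝ), 0 < ε → 1 ≤ R →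
      ∃ (w : ℕ) (Q : Circuit l m n ((qubits l + qubits n) + w)),
        (Q.time : ℝ) ≤ K * (R ^ 3 / ε) * Real.log (2 + l * m * n * R / ε) ^ c ∧
        ∀ (A : Matrix (Fin l) (Fin m) ℝ) (B : Matrix (Fin m) (Fin n) ℝ)
          (O : OracleFamily l m n),
          A * B ≠ 0 → ‖A‖ * ‖B‖ / ‖A * B‖ ≤ R → Prepares O A B →
          Q.Obtains O (matState (A * B)) ε := by
  obtain ⟨K, hK⟩ := mainTheorem4_general
  refine ⟨4 * K, 1, fun l m n ε R hε hR => ?_⟩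
  obtain ⟨w, Q, hQ, hobtains⟩ := hK l m n ε R hε hR
  refine ⟨w, Q, hQ.trans ?_, hobtains⟩
  have hlog := log_two_add_nonneg l m n hε (by positivity : 0 ≤ R)
  have hposLog : Real.posLog (4 / ε) ≤ 4 / ε :=
    max_le (by positivity) (Real.log_le_self (by positivity))
  calc _ ≤ K * (R ^ 3 * (4 / ε)) * Real.log (2 + l * m * n * R / ε) := by
        gcongr
        · exact Real.posLog_nonneg
        · norm_num
    _ = _ := by push_cast; ring
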